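/- Let $1/2<H<1$, $a>0$, $\nu\in\mathbb R$, and let $B^H=(B^H_t)_{t\ge 0}$ be a (real) fractional Brownian motion with Hurst index $H$ on a probability space $(\Omega,\mathcal F,\mu)$, i.e. a centered continuous Gaussian process with $E[B^H_tB^H_s]=\frac12\left(t^{2H}+s^{2H}-|t-s|^{2H}\right)$ for $s,t\ge0$. Let $X^H=(X^H_t)_{t\ge0}$ be a process with continuous paths solving the linear fractional self-attracting equation $$X^H_t=B^H_t-a\int_0^t\int_0^s(X^H_s-X^H_u)\,du\,ds+\nu t,\qquad t\ge0,$$ almost surely. Put $$h(s)=1-a\,s\,e^{\frac a2s^2}\int_s^\infty e^{-\frac a2u^2}\,du,\qquad s\ge0.$$ Then $h$ is Lebesgue integrable on $(0,\infty)$, the stochastic integral $\int_0^\infty h(s)\,dB^H_s$ exists, and almost surely $$\lim_{t\to\infty}X^H_t=X^H_\infty:=\int_0^\infty h(s)\,dB^H_s+\nu\int_0^\infty h(s)\,ds .$$ Here, for a deterministic measurable $f$ on $(0,\infty)$ such that $\int_0^\infty\!\int_0^\infty f(s)f(t)\phi(s,t)\,ds\,dt$ converges absolutely, where $\phi(s,t)=H(2H-1)|s-t|^{2H-2}$,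 the integral $\int_0^\infty f\,dB^H$ is the $L^2(\mu)$-limit (unique up to almost sure equality) of the integrals $\sum_i c_i(B^H_{t_i}-B^H_0)$ of step functions $\sum_i c_i1_{(0,t_i]}$ which converge to $f$ in the norm $\|g\|_\phi^2=\int_0^\infty\!\int_0^\infty g(s)g(t)\phi(s,t)\,ds\,dt$. -/

import Mathlib

open MeasureTheory ProbabilityTheory Filter Topology Set
open scoped NNReal ENNReal

noncomputable section

/-- `B` is a fractional Brownian motion with Hurst index `H` under `μ`: a centered Gaussian
process indexed by `[0, ∞)` with (almost surely) continuous paths and covariance function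
`(t ^ (2H) + s ^ (2H) - |t - s| ^ (2H)) / 2`. -/
structure IsFractionalBrownianMotion {Ω : Type*} [MeasurableSpace Ω] (H : ℝ) (μ : Measure Ω)
    (B : ℝ≥0 → Ω → ℝ) : Prop where
  gaussian : IsGaussianProcess B μ
  centered : ∀ t, ∫ ω, B t ω ∂μ = 0
  covariance : ∀ t s : ℝ≥0, ∫ ω, B t ω * B s ω ∂μ =
    ((t : ℝ) ^ (2 * H) + (s : ℝ) ^ (2 * H) - |(t : ℝ) - (s : ℝ)| ^ (2 * H)) / 2
  continuous_paths : ∀ᵐ ω ∂μ, Continuous fun t => B t ω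

/-- The kernel `φ(s, t) = H (2H - 1) |s - t| ^ (2H - 2)`. -/
def fbmKernel (H s t : ℝ) : ℝ := H * (2 * H - 1) * |s - t| ^ (2 * H - 2)

/-- Lebesgue measure on the quadrant `(0, ∞) × (0, ∞)`. -/
def quadrantMeasure : Measure (ℝ × ℝ) :=
  (volume.restrict (Ioi (0 : ℝ))).prod (volume.restrict (Ioi (0 : ℝ)))

/-- The space `L²_φ` of deterministic integrands on `(0, ∞)`: measurable functions `f` for which
`∫∫ f(s) f(t) φ(s, t) ds dt` converges (absolutely). Values of `f` outside `(0, ∞)` play no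
role. -/
def MemLphi (H : ℝ) (f : ℝ → ℝ) : Prop :=
  AEStronglyMeasurable f (volume.restrict (Ioi (0 : ℝ))) ∧
    Integrable (fun z : ℝ × ℝ => f z.1 * f z.2 * fbmKernel H z.1 z.2) quadrantMeasure

/-- The squared norm `∫∫ f(s) f(t) φ(s, t) ds dt` of the space `L²_φ`. -/
def phiNormSq (H : ℝ) (f : ℝ → ℝ) : ℝ :=
  ∫ z : ℝ × ℝ, f z.1 * f z.2 * fbmKernel H z.1 z.2 ∂quadrantMeasure

/-- The step function `∑ᵢ cᵢ 1_{(0, tᵢ]}`, encoded by the finitely supported `tᵢ ↦ cᵢ`. Every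
step function `∑ⱼ dⱼ 1_{(aⱼ, bⱼ]}` on `(0, ∞)` is of this form. -/
def stepFunction (p : ℝ≥0 →₀ ℝ) (s : ℝ) : ℝ :=
  p.sum fun t c => c * (Ioc (0 : ℝ) (t : ℝ)).indicator 1 s

/-- The integral `∑ᵢ cᵢ (B_{tᵢ} - B_0)` of a step function `∑ᵢ cᵢ 1_{(0, tᵢ]}` against `B`. -/
def stepIntegral {Ω : Type*} (B : ℝ≥0 → Ω → ℝ) (p : ℝ≥0 →₀ ℝ) (ω : Ω) : ℝ :=
  p.sum fun t c => c * (B t ω - B 0 ω)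

/-- `I` is (a version of) the stochastic integral `∫₀^∞ f(s) dB_s` of the deterministic integrand
`f` against the fractional Brownian motion `B`: it is the `L²(μ)`-limit of the integrals of step
functions that converge to `f` in `L²_φ`. For `B` a fractional Brownian motion with
`1/2 < H < 1` the map from step functions to `L²(μ)` is an isometry for the norm of `L²_φ`, so
this determines `I` up to almost sure equality. -/
def IsFbmIntegral {Ω : Type*} [MeasurableSpace Ω] (H : ℝ) (μ : Measure Ω) (B : ℝ≥0 → Ω → ℝ)
    (f : ℝ → ℝ) (I : Ω → ℝ) : Prop :=
  MemLphi H f ∧ MemLp I 2 μ ∧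
    ∃ p : ℕ → ℝ≥0 →₀ ℝ,
      Tendsto (fun n => phiNormSq H fun s => f s - stepFunction (p n) s) atTop (𝓝 0) ∧
      Tendsto (fun n => eLpNorm (fun ω => stepIntegral B (p n) ω - I ω) 2 μ) atTop (𝓝 0)

/-- `X` is a solution of the linear self-attracting equation driven by `B`,
`X_t = B_t - a ∫₀ᵗ ∫₀ˢ (X_s - X_u) du ds + ν t`, with continuous paths. -/
structure IsLinearSelfAttractingDiffusion {Ω : Type*} [MeasurableSpace Ω] (μ : Measure Ω)
    (B : ℝ≥0 → Ω → ℝ) (a ν : ℝ) (X : ℝ≥0 → Ω → ℝ) : Prop where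
  continuous_paths : ∀ᵐ ω ∂μ, Continuous fun t => X t ω
  equation : ∀ᵐ ω ∂μ, ∀ t : ℝ≥0, X t ω =
    B t ω - a * (∫ s in (0 : ℝ)..t, ∫ u in (0 : ℝ)..s, (X s.toNNReal ω - X u.toNNReal ω)) + ν * t

/-- The function `h(s) = 1 - a s exp(a s² / 2) ∫_s^∞ exp(-a u² / 2) du`. -/
def limitKernel (a s : ℝ) : ℝ :=
  1 - a * s * Real.exp (a * s ^ 2 / 2) * ∫ u in Ioi s, Real.exp (-(a * u ^ 2 / 2))

end

/-!
# Convergence of the linear fractional self-attracting diffusion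

The equation is solved path by path. Write `b t = B t + ν t` for the driving path,
`m(s) = exp (a s² / 2) ∫_s^∞ exp (-a u² / 2) du` for the Mills ratio, so that `h = 1 - a s m`, and
`k = -h' = a m - a s h`. With `Y t = ∫₀ᵗ (X t - X u) du` the equation is a linear system for `X - b`
and `Y`, whose solution is

  `X t = h(t) b t + ∫₀ᵗ k(u) b u du + a m(t) Y t`,
  `Y t = exp (-a t² / 2) ∫₀ᵗ (1 + a u²) exp (a u² / 2) (b t - b u) du`

(`tendsto_of_linear_selfAttracting`). Since `h(t) = ∫₀^∞ a v exp (-a t v - a v² / 2) dv` is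
`O(t⁻²)`, `k(t) = O(t⁻³)` and `m(t) ≤ 1 / (a t)`, the first term vanishes at infinity when `b` grows
more slowly than `t²`, and the last one when the oscillation of `b` over windows of length `1 / t`
tends to `0`; then `X t → ∫₀^∞ k(u) b u du`. For fractional Brownian motion both properties follow
from one quantitative modulus of continuity, obtained by chaining over dyadic points from the fourth
moments of the increments; the exponents that make the sums converge exist because `H > 1 / 2`
(`IsFractionalBrownianMotion.ae_exists_hasPolynomialModulus`).

It remains to identify `L = ∫₀^∞ k(u) B_u du` with `∫₀^∞ h dB`. As `h(s) = ∫_s^∞ k(u) du` is a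
mixture of the functions `1_{(0, u]}`, Fubini's theorem and `∫₀ᵘ ∫₀ᵛ φ = R(u, v)`, the covariance of
`B`, give the isometry `E (∫ p dB - L)² = ‖h - p‖²_φ` for every step function `p`
(`IsFractionalBrownianMotion.isometry_limitKernel`). Hence the integrals of any step functions that
converge to `h` in `L²_φ` converge to `L` in `L²`, which gives uniqueness without using that `φ` is
positive semidefinite. Such step functions exist: sampling the decreasing function `h` on a grid
yields step functions between `0` and `h`, to which dominated convergence applies.
-/

noncomputable section

/-! ### The limit kernel, its density and the Mills ratio -/

/-- The Mills ratio `exp (a s² / 2) ∫_s^∞ exp (-a u² / 2) du` of the centered Gaussian law with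
variance `1 / a`. -/
def millsRatio (a s : ℝ) : ℝ :=
  Real.exp (a * s ^ 2 / 2) * ∫ u in Ioi s, Real.exp (-(a * u ^ 2 / 2))

/-- The density `k = -h'` of `h = limitKernel a`, so that `h s = ∫_s^∞ k`. -/
def limitDensity (a s : ℝ) : ℝ :=
  a * millsRatio a s - a * s * limitKernel a s

theorem limitKernel_eq (a s : ℝ) : limitKernel a s = 1 - a * s * millsRatio a s := by
  unfold limitKernel millsRatio; ring

theorem integrable_exp_neg_mul_sq_div_two {a : ℝ} (ha : 0 < a) :
    Integrable fun u : ℝ => Real.exp (-(a * u ^ 2 / 2)) := by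
  convert integrable_exp_neg_mul_sq (half_pos ha) using 3
  ring

theorem hasDerivAt_exp_mul_sq_div_two (a s : ℝ) :
    HasDerivAt (fun s => Real.exp (a * s ^ 2 / 2)) (a * s * Real.exp (a * s ^ 2 / 2)) s := by
  have h : HasDerivAt (fun s => a * s ^ 2 / 2) (a * s) s := by
    refine ((((hasDerivAt_id' s).fun_pow 2).const_mul a).div_const 2).congr_deriv ?_
    norm_num; ring
  exact h.exp.congr_deriv (mul_comm _ _)

theorem hasDerivAt_millsRatio {a : ℝ} (ha : 0 < a) (s : ℝ) :
    HasDerivAt (millsRatio a) (a * s * millsRatio a s - 1) s := by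
  have hint := integrable_exp_neg_mul_sq_div_two ha
  have hcont : Continuous fun u : ℝ => Real.exp (-(a * u ^ 2 / 2)) := by fun_prop
  have h1 : HasDerivAt (fun s : ℝ => ∫ u in Ioi s, Real.exp (-(a * u ^ 2 / 2)))
      (-Real.exp (-(a * s ^ 2 / 2))) s := by
    have h2 : (fun s : ℝ => ∫ u in Ioi s, Real.exp (-(a * u ^ 2 / 2))) = fun s =>
        (∫ u in Ioi 0, Real.exp (-(a * u ^ 2 / 2))) -
          ∫ u in (0 : ℝ)..s, Real.exp (-(a * u ^ 2 / 2)) := by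
      funext s
      rw [eq_sub_iff_add_eq, add_comm]
      exact intervalIntegral.integral_interval_add_Ioi hint.integrableOn hint.integrableOn
    rw [h2]
    exact (intervalIntegral.integral_hasDerivAt_right (hcont.intervalIntegrable _ _)
      hcont.stronglyMeasurable.stronglyMeasurableAtFilter hcont.continuousAt).const_sub _
  refine ((hasDerivAt_exp_mul_sq_div_two a s).mul h1).congr_deriv ?_
  have h3 : Real.exp (a * s ^ 2 / 2) * Real.exp (-(a * s ^ 2 / 2)) = 1 := by
    rw [← Real.exp_add]; simp
  unfold millsRatio
  linear_combination -h3

theorem hasDerivAt_limitKernel {a : ℝ} (ha : 0 < a) (s : ℝ) :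
    HasDerivAt (limitKernel a) (-limitDensity a s) s := by
  have h : limitKernel a = fun s => 1 - a * s * millsRatio a s := funext (limitKernel_eq a)
  rw [h]
  refine ((((hasDerivAt_id' s).const_mul a).fun_mul
    (hasDerivAt_millsRatio ha s)).const_sub 1).congr_deriv ?_
  rw [limitDensity, limitKernel_eq]
  ring

theorem continuous_millsRatio {a : ℝ} (ha : 0 < a) : Continuous (millsRatio a) :=
  continuous_iff_continuousAt.2 fun s => (hasDerivAt_millsRatio ha s).continuousAt

theorem continuous_limitKernel {a : ℝ} (ha : 0 < a) : Continuous (limitKernel a) :=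
  continuous_iff_continuousAt.2 fun s => (hasDerivAt_limitKernel ha s).continuousAt

theorem continuous_limitDensity {a : ℝ} (ha : 0 < a) : Continuous (limitDensity a) := by
  have h1 := continuous_millsRatio ha
  have h2 := continuous_limitKernel ha
  unfold limitDensity
  fun_prop

theorem integrableOn_pow_mul_exp_quadratic {a s : ℝ} (ha : 0 < a) (hs : 0 ≤ s) (j : ℕ) :
    IntegrableOn (fun v : ℝ => v ^ j * Real.exp (-(a * s * v) - a * v ^ 2 / 2)) (Ioi 0) := by
  have h := integrableOn_rpow_mul_exp_neg_mul_sq (half_pos ha) (s := (j : ℝ))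
    (by have : (0 : ℝ) ≤ j := j.cast_nonneg
        linarith)
  refine Integrable.mono' h (by fun_prop) ((ae_restrict_iff' measurableSet_Ioi).2
    (Eventually.of_forall fun v (hv : 0 < v) => ?_))
  rw [Real.norm_eq_abs, abs_of_nonneg (by positivity), Real.rpow_natCast]
  have : 0 ≤ a * s * v := by positivity
  gcongr
  nlinarith

theorem tendsto_pow_mul_exp_quadratic {a s : ℝ} (ha : 0 < a) (hs : 0 ≤ s) (j : ℕ) :
    Tendsto (fun v : ℝ => v ^ j * Real.exp (-(a * s * v) - a * v ^ 2 / 2)) atTop (𝓝 0) := by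
  have h := (rpow_mul_exp_neg_mul_sq_isLittleO_exp_neg (half_pos ha) (j : ℝ)).isBigO.trans_tendsto
    (Real.tendsto_exp_atBot.comp (tendsto_neg_atTop_atBot.comp
      (tendsto_id.const_mul_atTop (by norm_num : (0 : ℝ) < 1 / 2))) |>.congr fun x => by
        simp)
  refine squeeze_zero' ?_ ?_ h
  · filter_upwards [eventually_ge_atTop 0] with v hv
    positivity
  · filter_upwards [eventually_ge_atTop 0] with v hv
    rw [Real.rpow_natCast]
    have : 0 ≤ a * s * v := by positivity
    gcongr
    nlinarith

theorem hasDerivAt_exp_quadratic (a s v : ℝ) :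
    HasDerivAt (fun v : ℝ => Real.exp (-(a * s * v) - a * v ^ 2 / 2))
      (-(a * s + a * v) * Real.exp (-(a * s * v) - a * v ^ 2 / 2)) v := by
  have h : HasDerivAt (fun v : ℝ => -(a * s * v) - a * v ^ 2 / 2) (-(a * s + a * v)) v := by
    refine ((((hasDerivAt_id' v).const_mul (a * s)).fun_neg).fun_sub
      ((((hasDerivAt_id' v).fun_pow 2).const_mul a).div_const 2)).congr_deriv ?_
    norm_num; ring
  exact h.exp.congr_deriv (mul_comm _ _)

theorem millsRatio_eq_integral (a s : ℝ) :
    millsRatio a s = ∫ v in Ioi 0, Real.exp (-(a * s * v) - a * v ^ 2 / 2) := by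
  have h := (measurePreserving_add_right (volume : Measure ℝ) s).setIntegral_preimage_emb
    (measurableEmbedding_addRight s) (fun u => Real.exp (-(a * u ^ 2 / 2))) (Ioi s)
  have hp : (fun x => x + s) ⁻¹' Ioi s = Ioi 0 := by ext x; simp
  rw [hp] at h
  rw [millsRatio, ← h, ← integral_const_mul]
  congr 1
  funext v
  rw [← Real.exp_add]
  congr 1
  ring

theorem limitKernel_eq_integral {a s : ℝ} (ha : 0 < a) (hs : 0 ≤ s) :
    limitKernel a s = a * ∫ v in Ioi 0, v ^ 1 * Real.exp (-(a * s * v) - a * v ^ 2 / 2) := by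
  have i0 := integrableOn_pow_mul_exp_quadratic ha hs 0
  have i1 := integrableOn_pow_mul_exp_quadratic ha hs 1
  have t0 := tendsto_pow_mul_exp_quadratic ha hs 0
  simp only [pow_zero, one_mul] at i0 t0
  have key : ∫ v in Ioi 0, (-(a * s + a * v) * Real.exp (-(a * s * v) - a * v ^ 2 / 2)) = 0 - 1 := by
    have e : (fun v : ℝ => -(a * s + a * v) * Real.exp (-(a * s * v) - a * v ^ 2 / 2)) = fun v =>
        (-(a * s)) * Real.exp (-(a * s * v) - a * v ^ 2 / 2) +
          (-a) * (v ^ 1 * Real.exp (-(a * s * v) - a * v ^ 2 / 2)) := by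
      funext v; ring
    have := integral_Ioi_of_hasDerivAt_of_tendsto' (a := 0)
      (fun v _ => hasDerivAt_exp_quadratic a s v)
      (by rw [e]; exact (i0.const_mul _).add (i1.const_mul _)) t0
    simpa using this
  have e : ∫ v in Ioi 0, (-(a * s + a * v) * Real.exp (-(a * s * v) - a * v ^ 2 / 2)) =
      (-(a * s)) * millsRatio a s +
        (-a) * ∫ v in Ioi 0, v ^ 1 * Real.exp (-(a * s * v) - a * v ^ 2 / 2) := by
    rw [millsRatio_eq_integral, ← integral_const_mul, ← integral_const_mul,
      ← integral_add (i0.const_mul _) (i1.const_mul _)]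
    congr 1; funext v; ring
  rw [limitKernel_eq]
  linarith

theorem limitDensity_eq_integral {a s : ℝ} (ha : 0 < a) (hs : 0 ≤ s) :
    limitDensity a s = a ^ 2 * ∫ v in Ioi 0, v ^ 2 * Real.exp (-(a * s * v) - a * v ^ 2 / 2) := by
  have i0 := integrableOn_pow_mul_exp_quadratic ha hs 0
  have i1 := integrableOn_pow_mul_exp_quadratic ha hs 1
  have i2 := integrableOn_pow_mul_exp_quadratic ha hs 2
  have t1 := tendsto_pow_mul_exp_quadratic ha hs 1
  simp only [pow_zero, one_mul] at i0
  have d1 (v : ℝ) : HasDerivAt (fun v : ℝ => v ^ 1 * Real.exp (-(a * s * v) - a * v ^ 2 / 2))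
      (Real.exp (-(a * s * v) - a * v ^ 2 / 2) +
        (-(a * s)) * (v ^ 1 * Real.exp (-(a * s * v) - a * v ^ 2 / 2)) +
        (-a) * (v ^ 2 * Real.exp (-(a * s * v) - a * v ^ 2 / 2))) v := by
    simp_rw [pow_one]
    refine ((hasDerivAt_id' v).fun_mul (hasDerivAt_exp_quadratic a s v)).congr_deriv ?_
    ring
  have key := integral_Ioi_of_hasDerivAt_of_tendsto' (a := 0) (fun v _ => d1 v)
    ((i0.add (i1.const_mul _)).add (i2.const_mul _)) t1
  rw [integral_add (by exact i0.add (i1.const_mul _)) (i2.const_mul _),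
    integral_add i0 (i1.const_mul _), integral_const_mul, integral_const_mul,
    ← millsRatio_eq_integral] at key
  rw [limitDensity, limitKernel_eq_integral ha hs]
  simp only [pow_one, zero_mul, sub_zero] at key ⊢
  linear_combination a * key

theorem integral_pow_mul_exp_quadratic_le {a s : ℝ} (ha : 0 < a) (hs : 0 < s) (j : ℕ) :
    ∫ v in Ioi 0, v ^ j * Real.exp (-(a * s * v) - a * v ^ 2 / 2) ≤
      j.factorial * (a * s)⁻¹ ^ (j + 1) := by
  have h := Real.integral_rpow_mul_exp_neg_mul_Ioi (a := j + 1) (by positivity) (mul_pos ha hs)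
  have hi : IntegrableOn (fun v : ℝ => v ^ ((j : ℝ) + 1 - 1) * Real.exp (-(a * s * v))) (Ioi 0) := by
    refine Integrable.of_integral_ne_zero ?_
    rw [h]
    have := Real.Gamma_pos_of_pos (s := (j : ℝ) + 1) (by positivity)
    positivity
  rw [Real.Gamma_nat_eq_factorial, mul_comm _ (j.factorial : ℝ), one_div, ← Nat.cast_succ,
    Real.rpow_natCast] at h
  rw [← h]
  refine setIntegral_mono_on (integrableOn_pow_mul_exp_quadratic ha hs.le j) (by simpa using hi)
    measurableSet_Ioi fun v (hv : 0 < v) => ?_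
  rw [Nat.cast_succ, add_sub_cancel_right, Real.rpow_natCast]
  gcongr
  have : 0 ≤ a * v ^ 2 / 2 := by positivity
  linarith

theorem integral_pow_mul_exp_quadratic_nonneg (a s : ℝ) (j : ℕ) :
    0 ≤ ∫ v in Ioi 0, v ^ j * Real.exp (-(a * s * v) - a * v ^ 2 / 2) :=
  setIntegral_nonneg measurableSet_Ioi fun v (hv : 0 < v) => by positivity

theorem millsRatio_nonneg (a s : ℝ) : 0 ≤ millsRatio a s := by
  rw [millsRatio_eq_integral]
  positivity

theorem millsRatio_le {a s : ℝ} (ha : 0 < a) (hs : 0 < s) : millsRatio a s ≤ (a * s)⁻¹ := by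
  have h := integral_pow_mul_exp_quadratic_le ha hs 0
  rw [millsRatio_eq_integral]
  simpa using h

theorem limitKernel_nonneg {a s : ℝ} (ha : 0 < a) (hs : 0 ≤ s) : 0 ≤ limitKernel a s := by
  rw [limitKernel_eq_integral ha hs]
  exact mul_nonneg ha.le (integral_pow_mul_exp_quadratic_nonneg a s 1)

theorem limitKernel_le {a s : ℝ} (ha : 0 < a) (hs : 0 < s) :
    limitKernel a s ≤ a⁻¹ * s ^ (-2 : ℝ) := by
  have h := integral_pow_mul_exp_quadratic_le ha hs 1
  rw [limitKernel_eq_integral ha hs.le, Real.rpow_neg hs.le, Real.rpow_two]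
  calc _ ≤ a * (Nat.factorial 1 * (a * s)⁻¹ ^ (1 + 1)) := by gcongr
    _ = _ := by simp; field_simp

theorem limitDensity_nonneg {a s : ℝ} (ha : 0 < a) (hs : 0 ≤ s) : 0 ≤ limitDensity a s := by
  rw [limitDensity_eq_integral ha hs]
  exact mul_nonneg (by positivity) (integral_pow_mul_exp_quadratic_nonneg a s 2)

theorem limitDensity_le {a s : ℝ} (ha : 0 < a) (hs : 0 < s) :
    limitDensity a s ≤ 2 * a⁻¹ * s ^ (-3 : ℝ) := by
  have h := integral_pow_mul_exp_quadratic_le ha hs 2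
  rw [limitDensity_eq_integral ha hs.le, Real.rpow_neg hs.le, show (3 : ℝ) = ((3 : ℕ) : ℝ) by simp,
    Real.rpow_natCast]
  calc _ ≤ a ^ 2 * (Nat.factorial 2 * (a * s)⁻¹ ^ (2 + 1)) := by gcongr
    _ = _ := by simp [Nat.factorial]; field_simp

theorem antitoneOn_limitKernel {a : ℝ} (ha : 0 < a) : AntitoneOn (limitKernel a) (Ici 0) := by
  refine antitoneOn_of_hasDerivWithinAt_nonpos (convex_Ici 0)
    (continuous_limitKernel ha).continuousOn
    (fun x _ => (hasDerivAt_limitKernel ha x).hasDerivWithinAt) fun x hx => ?_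
  rw [interior_Ici] at hx
  have := limitDensity_nonneg ha (le_of_lt hx)
  linarith

theorem tendsto_limitKernel {a : ℝ} (ha : 0 < a) : Tendsto (limitKernel a) atTop (𝓝 0) := by
  have h : Tendsto (fun s : ℝ => a⁻¹ * s ^ (-2 : ℝ)) atTop (𝓝 (a⁻¹ * 0)) :=
    (tendsto_rpow_neg_atTop (by norm_num)).const_mul _
  rw [mul_zero] at h
  refine squeeze_zero' ?_ ?_ h
  · filter_upwards [eventually_ge_atTop 0] with s hs using limitKernel_nonneg ha hs
  · filter_upwards [eventually_gt_atTop 0] with s hs using limitKernel_le ha hs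

theorem integrableOn_Ioi_of_continuous_of_le_rpow {q : ℝ → ℝ} (hq : Continuous q) {C r : ℝ}
    (hr : r < -1) (h : ∀ s, 1 ≤ s → |q s| ≤ C * s ^ r) : IntegrableOn q (Ioi 0) := by
  rw [← Ioc_union_Ioi_eq_Ioi zero_le_one]
  refine (hq.integrableOn_Ioc).union (Integrable.mono'
    ((integrableOn_Ioi_rpow_of_lt hr zero_lt_one).const_mul C) (by fun_prop) ?_)
  exact (ae_restrict_iff' measurableSet_Ioi).2 (Eventually.of_forall fun s (hs : 1 < s) =>
    h s hs.le)

theorem integrableOn_limitKernel {a : ℝ} (ha : 0 < a) : IntegrableOn (limitKernel a) (Ioi 0) :=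
  integrableOn_Ioi_of_continuous_of_le_rpow (continuous_limitKernel ha) (r := -2) (by norm_num)
    fun s hs => by
      rw [abs_of_nonneg (limitKernel_nonneg ha (by linarith))]
      exact limitKernel_le ha (by linarith)

/-- The density `k` decays like `s ^ (-3)`, so it integrates every path of growth below `s ^ 2`. -/
theorem integrableOn_limitDensity_mul {a : ℝ} (ha : 0 < a) {q : ℝ → ℝ} (hq : Continuous q)
    {C r : ℝ} (hr : r < 2) (h : ∀ s, 1 ≤ s → |q s| ≤ C * s ^ r) :
    IntegrableOn (fun s => limitDensity a s * q s) (Ioi 0) := by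
  refine integrableOn_Ioi_of_continuous_of_le_rpow ((continuous_limitDensity ha).mul hq)
    (C := 2 * a⁻¹ * C) (r := -3 + r) (by linarith) fun s hs => ?_
  have hs0 : 0 < s := by linarith
  rw [abs_mul, abs_of_nonneg (limitDensity_nonneg ha hs0.le), Real.rpow_add hs0]
  calc _ ≤ (2 * a⁻¹ * s ^ (-3 : ℝ)) * (C * s ^ r) :=
        mul_le_mul (limitDensity_le ha hs0) (h s hs) (abs_nonneg _) (by positivity)
    _ = _ := by ring

theorem integrableOn_limitDensity {a : ℝ} (ha : 0 < a) : IntegrableOn (limitDensity a) (Ioi 0) := by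
  simpa using integrableOn_limitDensity_mul ha (continuous_const (y := (1 : ℝ))) (C := 1) (r := 0)
    (by norm_num) (by simp)

theorem limitKernel_eq_integral_Ioi {a : ℝ} (ha : 0 < a) {s : ℝ} (hs : 0 ≤ s) :
    limitKernel a s = ∫ u in Ioi s, limitDensity a u := by
  have h := integral_Ioi_of_hasDerivAt_of_tendsto' (a := s)
    (fun v _ => hasDerivAt_limitKernel ha v)
    ((integrableOn_limitDensity ha).mono_set (Ioi_subset_Ioi hs)).neg (tendsto_limitKernel ha)
  rw [integral_neg] at h
  linarith

theorem integrableOn_limitDensity_mul_id {a : ℝ} (ha : 0 < a) :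
    IntegrableOn (fun s => limitDensity a s * s) (Ioi 0) :=
  integrableOn_limitDensity_mul ha continuous_id (C := 1) (r := 1) (by norm_num) fun s hs => by
    simp [abs_of_nonneg (zero_le_one.trans hs)]

theorem integral_limitDensity_mul_id {a : ℝ} (ha : 0 < a) :
    ∫ s in Ioi 0, limitDensity a s * s = ∫ s in Ioi 0, limitKernel a s := by
  have i1 := integrableOn_limitKernel ha
  have i2 := integrableOn_limitDensity_mul_id ha
  have d (s : ℝ) : HasDerivAt (fun s => s * limitKernel a s)
      (limitKernel a s - limitDensity a s * s) s := by
    refine ((hasDerivAt_id' s).fun_mul (hasDerivAt_limitKernel ha s)).congr_deriv ?_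
    ring
  have t : Tendsto (fun s => s * limitKernel a s) atTop (𝓝 0) := by
    have h : Tendsto (fun s : ℝ => a⁻¹ * s ^ (-1 : ℝ)) atTop (𝓝 (a⁻¹ * 0)) :=
      (tendsto_rpow_neg_atTop (by norm_num)).const_mul _
    rw [mul_zero] at h
    refine squeeze_zero' ?_ ?_ h
    · filter_upwards [eventually_ge_atTop 0] with s hs
      exact mul_nonneg hs (limitKernel_nonneg ha hs)
    · filter_upwards [eventually_gt_atTop 0] with s hs
      calc _ ≤ s * (a⁻¹ * s ^ (-2 : ℝ)) := by gcongr; exact limitKernel_le ha hs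
        _ = a⁻¹ * (s ^ (1 : ℝ) * s ^ (-2 : ℝ)) := by rw [Real.rpow_one]; ring
        _ = _ := by rw [← Real.rpow_add hs]; norm_num
  have h := integral_Ioi_of_hasDerivAt_of_tendsto' (a := 0) (fun v _ => d v) (i1.sub i2) t
  rw [integral_sub i1 i2] at h
  simp only [zero_mul, sub_zero] at h
  linarith

/-! ### Pathwise convergence of the solution -/

/-- `b` has modulus of continuity `C t ^ θ (δ ^ γ + δ)` on `[0, t]` at its right end point, for
all `t ≥ 1`. For `θ < γ` the oscillation of `b` over windows of length `1 / t` then tends to `0`. -/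
def HasPolynomialModulus (θ γ C : ℝ) (b : ℝ → ℝ) : Prop :=
  ∀ t, 1 ≤ t → ∀ u, 0 ≤ u → u ≤ t → |b t - b u| ≤ C * t ^ θ * ((t - u) ^ γ + (t - u))

theorem HasPolynomialModulus.add_linear {θ γ C : ℝ} {b : ℝ → ℝ} (h : HasPolynomialModulus θ γ C b)
    (hθ : 0 ≤ θ) (ν : ℝ) : HasPolynomialModulus θ γ (C + |ν|) fun t => b t + ν * t := by
  intro t ht u hu hut
  have h1 := h t ht u hu hut
  have h2 : |ν * (t - u)| ≤ |ν| * t ^ θ * ((t - u) ^ γ + (t - u)) := by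
    rw [abs_mul, abs_of_nonneg (sub_nonneg.2 hut), mul_assoc]
    have h3 := Real.one_le_rpow ht hθ
    have h4 : 0 ≤ t - u := sub_nonneg.2 hut
    have h5 := Real.rpow_nonneg h4 γ
    gcongr
    nlinarith
  calc |b t + ν * t - (b u + ν * u)| = |(b t - b u) + ν * (t - u)| := by congr 1; ring
    _ ≤ _ := abs_add_le _ _
    _ ≤ _ := add_le_add h1 h2
    _ = _ := by ring

theorem HasPolynomialModulus.abs_le {θ γ C : ℝ} {b : ℝ → ℝ} (h : HasPolynomialModulus θ γ C b)
    (hC : 0 ≤ C) (hγ : γ ≤ 1) (hb : b 0 = 0) {t : ℝ} (ht : 1 ≤ t) :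
    |b t| ≤ 2 * C * t ^ (θ + 1) := by
  have h0 : 0 < t := by linarith
  have h1 := h t ht 0 le_rfl h0.le
  rw [hb, sub_zero, sub_zero] at h1
  rw [Real.rpow_add h0, Real.rpow_one]
  have h2 : t ^ γ ≤ t := by simpa using Real.rpow_le_rpow_of_exponent_le ht hγ
  calc _ ≤ C * t ^ θ * (t ^ γ + t) := h1
    _ ≤ C * t ^ θ * (t + t) := by gcongr
    _ = _ := by ring

theorem integral_exp_mul_rpow_le {r q t : ℝ} (hr : 0 < r) (hq : 0 ≤ q) (ht : 0 ≤ t) :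
    ∫ v in (0 : ℝ)..t, Real.exp (-(r * v)) * v ^ q ≤ Real.Gamma (q + 1) * r ^ (-(q + 1)) := by
  have h := Real.integral_rpow_mul_exp_neg_mul_Ioi (a := q + 1) (by positivity) hr
  have hi : IntegrableOn (fun v : ℝ => v ^ (q + 1 - 1) * Real.exp (-(r * v))) (Ioi 0) := by
    refine Integrable.of_integral_ne_zero ?_
    rw [h]
    have := Real.Gamma_pos_of_pos (s := q + 1) (by positivity)
    positivity
  rw [one_div, Real.inv_rpow hr.le, ← Real.rpow_neg hr.le, mul_comm] at h
  rw [← h, intervalIntegral.integral_of_le ht]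
  simp_rw [add_sub_cancel_right, mul_comm _ (Real.exp _)] at hi ⊢
  refine setIntegral_mono_set hi ?_ (Ioc_subset_Ioi_self.eventuallyLE)
  exact (ae_restrict_iff' measurableSet_Ioi).2 (Eventually.of_forall fun v (hv : 0 < v) => by
    simp only [Pi.zero_apply]; positivity)

/-- The pathwise statement: a continuous driving path whose oscillation over windows of length
`1 / t` vanishes as `t → ∞` produces a convergent solution of the linear self-attracting equation.

With `z = x - b`, `V = t z - ∫₀ᵗ x` and `Y = V + t b` one has `z' = -a Y` and `V' = -b - a t Y`, and
this linear system is solved by `z = ∫₀ᵗ k b + a m V` (`m` the Mills ratio, `k` the density of the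
limit kernel) and by `Y = exp (-a t² / 2) ∫₀ᵗ (1 + a u²) exp (a u² / 2) (b t - b u) du`. Hence
`x = h b + ∫₀ᵗ k b + a m Y`, where the first and the last term vanish at infinity. -/
theorem tendsto_of_linear_selfAttracting {a : ℝ} (ha : 0 < a) {b x : ℝ → ℝ} (hb : Continuous b)
    (hx : Continuous x) (hb0 : b 0 = 0) {θ γ C : ℝ} (hC : 0 ≤ C) (hγ : γ < 1)
    (hγ0 : 0 ≤ γ) (hθγ : θ < γ) (hmod : HasPolynomialModulus θ γ C b)
    (heq : ∀ t, 0 ≤ t → x t = b t - a * ∫ s in (0 : ℝ)..t, ∫ u in (0 : ℝ)..s, (x s - x u)) :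
    Tendsto x atTop (𝓝 (∫ s in Ioi 0, limitDensity a s * b s)) := by
  set Y : ℝ → ℝ := fun s => s * x s - ∫ u in (0 : ℝ)..s, x u with hY
  have hxi (s t : ℝ) : IntervalIntegrable x volume s t := hx.intervalIntegrable s t
  have hYeq (s : ℝ) : ∫ u in (0 : ℝ)..s, (x s - x u) = Y s := by
    rw [intervalIntegral.integral_sub (by simp) (hxi _ _)]
    simp [hY]
  have hdx (t : ℝ) : HasDerivAt (fun t => ∫ u in (0 : ℝ)..t, x u) (x t) t :=
    intervalIntegral.integral_hasDerivAt_right (hxi _ _)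
      hx.stronglyMeasurable.stronglyMeasurableAtFilter hx.continuousAt
  have hYc : Continuous Y := by
    have : Continuous fun t => ∫ u in (0 : ℝ)..t, x u :=
      continuous_iff_continuousAt.2 fun t => (hdx t).continuousAt
    fun_prop
  set Z : ℝ → ℝ := fun t => -a * ∫ s in (0 : ℝ)..t, Y s with hZ
  set V : ℝ → ℝ := fun t => t * Z t - ∫ u in (0 : ℝ)..t, x u with hV
  have hdZ (t : ℝ) : HasDerivAt Z (-a * Y t) t :=
    (intervalIntegral.integral_hasDerivAt_right (hYc.intervalIntegrable _ _)
      hYc.stronglyMeasurable.stronglyMeasurableAtFilter hYc.continuousAt).const_mul _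
  have hxZ (t : ℝ) (ht : 0 ≤ t) : x t = b t + Z t := by
    rw [heq t ht]
    simp_rw [hYeq, hZ]
    ring
  have hYV (t : ℝ) (ht : 0 ≤ t) : Y t = V t + t * b t := by
    simp only [hY, hV]
    rw [hxZ t ht]; ring
  have hdV (t : ℝ) (ht : 0 ≤ t) : HasDerivAt V (-b t - a * t * Y t) t := by
    refine (((hasDerivAt_id' t).fun_mul (hdZ t)).fun_sub (hdx t)).congr_deriv ?_
    rw [hxZ t ht]; ring
  have hV0 : V 0 = 0 := by simp [hV]
  have hZ0 : Z 0 = 0 := by simp [hZ]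
  have hkb : Continuous fun t => limitDensity a t * b t := (continuous_limitDensity ha).mul hb
  have hdkb (t : ℝ) : HasDerivAt (fun t => ∫ s in (0 : ℝ)..t, limitDensity a s * b s)
      (limitDensity a t * b t) t :=
    intervalIntegral.integral_hasDerivAt_right (hkb.intervalIntegrable _ _)
      hkb.stronglyMeasurable.stronglyMeasurableAtFilter hkb.continuousAt
  have hZform (t : ℝ) (ht : 0 ≤ t) :
      Z t = (∫ s in (0 : ℝ)..t, limitDensity a s * b s) + a * millsRatio a t * V t := by
    have hd (t : ℝ) (ht : 0 ≤ t) : HasDerivAt (fun t => Z t -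
        (∫ s in (0 : ℝ)..t, limitDensity a s * b s) - a * millsRatio a t * V t) 0 t := by
      refine (((hdZ t).fun_sub (hdkb t)).fun_sub
        (((hasDerivAt_millsRatio ha t).const_mul a).fun_mul (hdV t ht))).congr_deriv ?_
      rw [hYV t ht, limitDensity, limitKernel_eq]
      ring
    have h := constant_of_has_deriv_right_zero (a := 0) (b := t)
      (fun s hs => (hd s hs.1).continuousAt.continuousWithinAt)
      (fun s hs => (hd s hs.1).hasDerivWithinAt) t ⟨ht, le_rfl⟩
    simp only [hZ0, hV0, intervalIntegral.integral_same, mul_zero, sub_zero] at h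
    linarith
  have hxform (t : ℝ) (ht : 0 ≤ t) : x t = limitKernel a t * b t +
      (∫ s in (0 : ℝ)..t, limitDensity a s * b s) + a * millsRatio a t * Y t := by
    rw [hxZ t ht, hZform t ht, hYV t ht, limitKernel_eq]
    ring
  have hYform (t : ℝ) (ht : 0 ≤ t) : Real.exp (a * t ^ 2 / 2) * Y t =
      ∫ u in (0 : ℝ)..t, Real.exp (a * u ^ 2 / 2) * (1 + a * u ^ 2) * (b t - b u) := by
    have hd (u : ℝ) (hu : u ∈ uIcc 0 t) : HasDerivAt
        (fun u => Real.exp (a * u ^ 2 / 2) * (V u + u * b t))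
        (Real.exp (a * u ^ 2 / 2) * (1 + a * u ^ 2) * (b t - b u)) u := by
      rw [uIcc_of_le ht] at hu
      refine ((hasDerivAt_exp_mul_sq_div_two a u).fun_mul
        ((hdV u hu.1).fun_add ((hasDerivAt_id' u).mul_const (b t)))).congr_deriv ?_
      rw [hYV u hu.1]
      ring
    have h := intervalIntegral.integral_eq_sub_of_hasDerivAt hd
      (Continuous.intervalIntegrable (by fun_prop) _ _)
    rw [h, hYV t ht, hV0]
    ring
  -- The factor `exp (-a (t² - u²) / 2) ≤ exp (-(a t / 2) (t - u))` localizes the integral to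
  -- `t - u` of order `1 / t`.
  have hYbound (t : ℝ) (ht : 1 ≤ t) : |Y t| ≤ (1 + a * t ^ 2) * (C * t ^ θ) *
      (Real.Gamma (γ + 1) * (a * t / 2) ^ (-(γ + 1)) +
        Real.Gamma (1 + 1) * (a * t / 2) ^ (-(1 + 1 : ℝ))) := by
    have ht0 : 0 < t := by linarith
    have hr : 0 < a * t / 2 := by positivity
    have e1 : Y t = ∫ u in (0 : ℝ)..t, Real.exp (-(a * t ^ 2 / 2)) *
        (Real.exp (a * u ^ 2 / 2) * (1 + a * u ^ 2) * (b t - b u)) := by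
      rw [intervalIntegral.integral_const_mul, ← hYform t ht0.le, ← mul_assoc, ← Real.exp_add]
      simp
    set g : ℝ → ℝ := fun v => (1 + a * t ^ 2) * (C * t ^ θ) *
      (Real.exp (-(a * t / 2 * v)) * v ^ γ + Real.exp (-(a * t / 2 * v)) * v ^ (1 : ℝ)) with hg
    have hgc : Continuous g := by fun_prop (disch := first | assumption | norm_num)
    have hgi (q : ℝ) (hq : 0 ≤ q) : IntervalIntegrable
        (fun v : ℝ => Real.exp (-(a * t / 2 * v)) * v ^ q) volume 0 t :=
      Continuous.intervalIntegrable (by fun_prop (disch := assumption)) _ _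
    have e2 : |Y t| ≤ ∫ u in (0 : ℝ)..t, g (t - u) := by
      rw [e1, ← Real.norm_eq_abs]
      refine intervalIntegral.norm_integral_le_of_norm_le ht0.le
        (Eventually.of_forall fun u hu => ?_)
        ((hgc.comp (continuous_sub_left t)).intervalIntegrable _ _)
      have hu0 : 0 ≤ u := hu.1.le
      have hm := hmod t ht u hu0 hu.2
      rw [Real.norm_eq_abs, ← mul_assoc, ← mul_assoc, ← Real.exp_add, abs_mul,
        abs_of_nonneg (by positivity)]
      have hsub : 0 ≤ t - u := sub_nonneg.2 hu.2
      calc _ ≤ Real.exp (-(a * t / 2 * (t - u))) * (1 + a * t ^ 2) *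
            (C * t ^ θ * ((t - u) ^ γ + (t - u))) := by
            have h1 : u ^ 2 ≤ t ^ 2 := by gcongr; exact hu.2
            have h2 : a * (u * (t - u)) ≥ 0 := by positivity
            gcongr
            nlinarith
        _ = g (t - u) := by simp only [hg, Real.rpow_one]; ring
    rw [intervalIntegral.integral_comp_sub_left, sub_self, sub_zero,
      intervalIntegral.integral_const_mul,
      intervalIntegral.integral_add (hgi γ hγ0) (hgi 1 zero_le_one)] at e2
    refine e2.trans ?_
    gcongr
    · exact integral_exp_mul_rpow_le hr hγ0 ht0.le
    · exact integral_exp_mul_rpow_le hr zero_le_one ht0.le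
  have hlast : Tendsto (fun t => a * millsRatio a t * Y t) atTop (𝓝 0) := by
    set K₁ := (1 + a) * C * (Real.Gamma (γ + 1) * (a / 2) ^ (-(γ + 1))) with hK₁
    set K₂ := (1 + a) * C * (Real.Gamma (1 + 1) * (a / 2) ^ (-(1 + 1 : ℝ))) with hK₂
    have hlim : Tendsto (fun t : ℝ => K₁ * t ^ (-(γ - θ)) + K₂ * t ^ (-(1 - θ))) atTop
        (𝓝 (K₁ * 0 + K₂ * 0)) :=
      ((tendsto_rpow_neg_atTop (by linarith)).const_mul _).add
        ((tendsto_rpow_neg_atTop (by linarith)).const_mul _)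
    rw [mul_zero, mul_zero, add_zero] at hlim
    refine squeeze_zero_norm' ?_ hlim
    filter_upwards [eventually_ge_atTop 1] with t ht
    have ht0 : 0 < t := by linarith
    have hm := millsRatio_le ha ht0
    have hm0 := millsRatio_nonneg a t
    have hG₁ : 0 < Real.Gamma (γ + 1) := Real.Gamma_pos_of_pos (by linarith)
    have hG₂ : 0 < Real.Gamma (1 + 1) := Real.Gamma_pos_of_pos (by norm_num)
    rw [Real.norm_eq_abs, abs_mul, abs_of_nonneg (by positivity)]
    calc _ ≤ a * (a * t)⁻¹ * (((1 + a) * t ^ 2) * (C * t ^ θ) *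
        (Real.Gamma (γ + 1) * (a * t / 2) ^ (-(γ + 1)) +
        Real.Gamma (1 + 1) * (a * t / 2) ^ (-(1 + 1 : ℝ)))) := by
          refine mul_le_mul (by gcongr) ((hYbound t ht).trans ?_) (abs_nonneg _) (by positivity)
          gcongr
          nlinarith
      _ = _ := by
        rw [mul_div_right_comm, Real.mul_rpow (by positivity) ht0.le,
          Real.mul_rpow (by positivity) ht0.le,
          show -(γ - θ) = 1 + θ + -(γ + 1) by ring, show -(1 - θ) = 1 + θ + -(1 + 1) by ring,
          Real.rpow_add ht0, Real.rpow_add ht0, Real.rpow_add ht0 (1 + θ),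
          Real.rpow_add ht0 1, Real.rpow_one, hK₁, hK₂]
        field_simp
  have hgrowth (t : ℝ) (ht : 1 ≤ t) : |b t| ≤ 2 * C * t ^ (θ + 1) := hmod.abs_le hC hγ.le hb0 ht
  have hfirst : Tendsto (fun t => limitKernel a t * b t) atTop (𝓝 0) := by
    have hlim : Tendsto (fun t : ℝ => a⁻¹ * (2 * C) * t ^ (-(1 - θ))) atTop
        (𝓝 (a⁻¹ * (2 * C) * 0)) := (tendsto_rpow_neg_atTop (by linarith)).const_mul _
    rw [mul_zero] at hlim
    refine squeeze_zero_norm' ?_ hlim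
    filter_upwards [eventually_ge_atTop 1] with t ht
    have ht0 : 0 < t := by linarith
    rw [norm_mul, Real.norm_eq_abs, Real.norm_eq_abs,
      abs_of_nonneg (limitKernel_nonneg ha ht0.le)]
    calc _ ≤ (a⁻¹ * t ^ (-2 : ℝ)) * (2 * C * t ^ (θ + 1)) :=
          mul_le_mul (limitKernel_le ha ht0) (hgrowth t ht) (abs_nonneg _) (by positivity)
      _ = _ := by
        rw [show -(1 - θ) = -2 + (θ + 1) by ring, Real.rpow_add ht0 (-2)]
        ring
  have hmid : Tendsto (fun t => ∫ s in (0 : ℝ)..t, limitDensity a s * b s) atTop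
      (𝓝 (∫ s in Ioi 0, limitDensity a s * b s)) :=
    intervalIntegral_tendsto_integral_Ioi 0
      (integrableOn_limitDensity_mul ha hb (by linarith) hgrowth) tendsto_id
  have hsum := (hfirst.add hmid).add hlast
  rw [zero_add, add_zero] at hsum
  refine hsum.congr' ?_
  filter_upwards [eventually_ge_atTop 0] with t ht using (hxform t ht).symm

/-! ### Chaining along dyadic points -/

/-- Chaining along dyadic points: increments over the dyadic intervals `[j 2⁻ᵏ, (j + 1) 2⁻ᵏ]` of
size at most `A 2 ^ (-γ k) (1 + j 2⁻ᵏ) ^ θ` give a polynomial modulus of continuity. -/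
theorem exists_hasPolynomialModulus_of_dyadic {b : ℝ → ℝ} (hb : Continuous b) {θ γ A : ℝ}
    (hθ : 0 ≤ θ) (hγ : 0 < γ) (hA : 0 ≤ A)
    (h : ∀ k j : ℕ, |b ((j + 1 : ℕ) / 2 ^ k) - b (j / 2 ^ k)| ≤
      A * ((1 / 2 : ℝ) ^ γ) ^ k * (1 + j / 2 ^ k) ^ θ) :
    ∃ C, 0 ≤ C ∧ HasPolynomialModulus θ γ C b := by
  set ρ : ℝ := (1 / 2 : ℝ) ^ γ with hρ
  have hρ0 : 0 < ρ := by positivity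
  have hρ1 : ρ < 1 := Real.rpow_lt_one (by norm_num) (by norm_num) hγ
  have hρ1' : 0 < 1 - ρ := sub_pos.2 hρ1
  set M : ℝ := 2 + 2 / (1 - ρ) with hM
  have hM2 : 0 < 2 / (1 - ρ) := by positivity
  have hM0 : 0 < M := by positivity
  have hstep (T : ℝ) (k j : ℕ) (hj : (j : ℝ) / 2 ^ k ≤ T) :
      dist (b (j / 2 ^ k)) (b ((j + 1 : ℕ) / 2 ^ k)) ≤ A * (1 + T) ^ θ * ρ ^ k := by
    rw [dist_comm, Real.dist_eq]
    refine (h k j).trans ?_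
    rw [mul_right_comm]
    gcongr
  have hfloor (v : ℝ) (hv : 0 ≤ v) (k : ℕ) : (⌊v * 2 ^ k⌋₊ : ℝ) / 2 ^ k ≤ v := by
    rw [div_le_iff₀ (by positivity)]
    exact Nat.floor_le (by positivity)
  have hfine (T v : ℝ) (hv : 0 ≤ v) (hvT : v ≤ T) (k : ℕ) :
      dist (b (⌊v * 2 ^ k⌋₊ / 2 ^ k)) (b v) ≤ A * (1 + T) ^ θ * ρ ^ k / (1 - ρ) := by
    have hlim : Tendsto (fun k : ℕ => b (⌊v * 2 ^ k⌋₊ / 2 ^ k)) atTop (𝓝 (b v)) :=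
      (hb.tendsto v).comp ((tendsto_nat_floor_mul_div_atTop hv).comp
        (tendsto_pow_atTop_atTop_of_one_lt (one_lt_two (α := ℝ))))
    refine dist_le_of_le_geometric_of_tendsto ρ _ hρ1 (fun n => ?_) hlim k
    have hT : 0 ≤ A * (1 + T) ^ θ * ρ ^ n := by
      have : 0 ≤ 1 + T := by linarith
      positivity
    -- The dyadic floor at level `n + 1` is the one at level `n` or its right neighbour.
    have e0 : (⌊v * 2 ^ n⌋₊ : ℝ) / 2 ^ n = (2 * ⌊v * 2 ^ n⌋₊ : ℕ) / 2 ^ (n + 1) := by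
      push_cast; field_simp; ring
    have hcase : ⌊v * 2 ^ (n + 1)⌋₊ = 2 * ⌊v * 2 ^ n⌋₊ ∨
        ⌊v * 2 ^ (n + 1)⌋₊ = 2 * ⌊v * 2 ^ n⌋₊ + 1 := by
      have h1 := Nat.floor_le (a := v * 2 ^ n) (by positivity)
      have h2 := Nat.lt_floor_add_one (v * 2 ^ n)
      have h3 : 2 * ⌊v * 2 ^ n⌋₊ ≤ ⌊v * 2 ^ (n + 1)⌋₊ := by
        refine Nat.le_floor ?_
        rw [pow_succ]; push_cast; linarith
      have h4 : ⌊v * 2 ^ (n + 1)⌋₊ < 2 * ⌊v * 2 ^ n⌋₊ + 2 := by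
        rw [Nat.floor_lt (by positivity), pow_succ]; push_cast; linarith
      omega
    rw [e0]
    rcases hcase with hc | hc <;> rw [hc]
    · rwa [dist_self]
    · refine (hstep T (n + 1) _ (by rw [← e0]; exact (hfloor v hv n).trans hvT)).trans ?_
      have : 0 ≤ 1 + T := by linarith
      gcongr A * (1 + T) ^ θ * ?_
      exact pow_le_pow_of_le_one hρ0.le hρ1.le n.le_succ
  have hall (t u : ℝ) (hu : 0 ≤ u) (hut : u ≤ t) (k : ℕ) :
      |b t - b u| ≤ A * (1 + t) ^ θ * ρ ^ k * ((t - u) * 2 ^ k + 1 + 2 / (1 - ρ)) := by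
    have ht : 0 ≤ t := hu.trans hut
    have hmn : ⌊u * 2 ^ k⌋₊ ≤ ⌊t * 2 ^ k⌋₊ := Nat.floor_mono (by gcongr)
    have hmid := dist_le_Ico_sum_of_dist_le (f := fun j : ℕ => b (j / 2 ^ k)) hmn
      (d := fun _ => A * (1 + t) ^ θ * ρ ^ k) (fun {j} _ hj => hstep t k j (by
        refine le_trans ?_ (hfloor t ht k)
        gcongr))
    rw [Finset.sum_const, Nat.card_Ico, nsmul_eq_mul, Nat.cast_sub hmn] at hmid
    have hcount : (⌊t * 2 ^ k⌋₊ : ℝ) - ⌊u * 2 ^ k⌋₊ ≤ (t - u) * 2 ^ k + 1 := by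
      have h1 := Nat.floor_le (a := t * 2 ^ k) (by positivity)
      have h2 := Nat.lt_floor_add_one (u * 2 ^ k)
      linarith
    have hK : 0 ≤ A * (1 + t) ^ θ * ρ ^ k := by positivity
    have h1 := hfine t t ht le_rfl k
    have h2 := hfine t u hu hut k
    rw [dist_comm] at h1
    have htri := dist_triangle4 (b t) (b (⌊t * 2 ^ k⌋₊ / 2 ^ k)) (b (⌊u * 2 ^ k⌋₊ / 2 ^ k)) (b u)
    rw [dist_comm (b (⌊t * 2 ^ k⌋₊ / 2 ^ k))] at htri
    rw [← Real.dist_eq]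
    calc _ ≤ A * (1 + t) ^ θ * ρ ^ k / (1 - ρ) +
          ((t - u) * 2 ^ k + 1) * (A * (1 + t) ^ θ * ρ ^ k) +
          A * (1 + t) ^ θ * ρ ^ k / (1 - ρ) := by
          refine htri.trans (add_le_add (add_le_add h1 (hmid.trans ?_)) h2)
          gcongr
      _ = _ := by ring
  refine ⟨A * 2 ^ θ * (2 ^ γ * M), by positivity, fun t ht u hu hut => ?_⟩
  have ht0 : 0 < t := by linarith
  have hT : (1 + t) ^ θ ≤ 2 ^ θ * t ^ θ := by
    rw [← Real.mul_rpow (by norm_num) ht0.le]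
    gcongr
    linarith
  have h2γ : 1 ≤ (2 : ℝ) ^ γ := Real.one_le_rpow (by norm_num) hγ.le
  rcases hut.eq_or_lt with rfl | hlt
  · simp only [sub_self, abs_zero]
    have := Real.rpow_nonneg (le_refl (0 : ℝ)) γ
    positivity
  have hδ : 0 < t - u := sub_pos.2 hlt
  have hδγ : 0 < (t - u) ^ γ := Real.rpow_pos_of_pos hδ γ
  -- At the level `k` with `2⁻ᵏ` of order `t - u` (`k = 0` for long intervals) all terms balance.
  have hkey : ∃ k : ℕ, ρ ^ k * ((t - u) * 2 ^ k + 1 + 2 / (1 - ρ)) ≤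
      2 ^ γ * M * ((t - u) ^ γ + (t - u)) := by
    rcases le_total 1 (t - u) with h1 | h1
    · refine ⟨0, ?_⟩
      simp only [pow_zero, mul_one, one_mul]
      calc _ ≤ M * (t - u) := by rw [hM]; nlinarith
        _ ≤ 2 ^ γ * M * (t - u) := by
          gcongr
          exact le_mul_of_one_le_left hM0.le h2γ
        _ ≤ _ := by gcongr; linarith
    · obtain ⟨k, hk1, hk2⟩ := exists_nat_pow_near_of_lt_one hδ h1 (y := (1 / 2 : ℝ))
        (by norm_num) (by norm_num)
      refine ⟨k, ?_⟩
      have e1 : (t - u) * 2 ^ k ≤ 1 := by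
        calc _ ≤ (1 / 2 : ℝ) ^ k * 2 ^ k := by gcongr
          _ = 1 := by rw [← mul_pow]; norm_num
      have e2 : ρ ^ k ≤ 2 ^ γ * (t - u) ^ γ := by
        have e3 : (1 / 2 : ℝ) ^ k ≤ 2 * (t - u) := by
          rw [pow_succ] at hk1; linarith
        rw [hρ, ← Real.rpow_natCast, ← Real.rpow_mul (by norm_num), mul_comm,
          Real.rpow_mul (by norm_num), Real.rpow_natCast,
          ← Real.mul_rpow (by norm_num) hδ.le]
        gcongr
      calc _ ≤ (2 ^ γ * (t - u) ^ γ) * M := by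
            rw [hM]
            gcongr
            linarith
        _ = 2 ^ γ * M * (t - u) ^ γ := by ring
        _ ≤ _ := by gcongr; linarith
  obtain ⟨k, hk⟩ := hkey
  calc |b t - b u| ≤ A * (1 + t) ^ θ * (ρ ^ k * ((t - u) * 2 ^ k + 1 + 2 / (1 - ρ))) := by
        rw [← mul_assoc]; exact hall t u hu hut k
    _ ≤ A * (2 ^ θ * t ^ θ) * (2 ^ γ * M * ((t - u) ^ γ + (t - u))) := by gcongr
    _ = _ := by ring

/-! ### Paths of fractional Brownian motion -/

/-- The fourth absolute moment of the standard Gaussian law. -/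
def gaussianFourthMoment : ℝ≥0∞ := ∫⁻ x, ‖x‖ₑ ^ 4 ∂(gaussianReal 0 1)

theorem gaussianFourthMoment_lt_top : gaussianFourthMoment < ∞ := by
  have h := (memLp_id_gaussianReal (μ := 0) (v := 1) 4).2
  rw [eLpNorm_lt_top_iff_lintegral_rpow_enorm_lt_top (by norm_num) (by norm_num)] at h
  refine lt_of_eq_of_lt ?_ h
  unfold gaussianFourthMoment
  congr 1
  funext x
  rw [id_eq, show ((4 : ℝ≥0) : ℝ≥0∞).toReal = ((4 : ℕ) : ℝ) by simp, ENNReal.rpow_natCast]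

section

variable {Ω : Type*} [MeasurableSpace Ω] {μ : Measure Ω}

theorem lintegral_enorm_pow_four_of_hasGaussianLaw {X : Ω → ℝ} (hX : HasGaussianLaw X μ)
    (h0 : ∫ ω, X ω ∂μ = 0) {σ : ℝ} (hσ : 0 ≤ σ) (h2 : ∫ ω, X ω ^ 2 ∂μ = σ ^ 2) :
    ∫⁻ ω, ‖X ω‖ₑ ^ 4 ∂μ = ENNReal.ofReal (σ ^ 4) * gaussianFourthMoment := by
  have hm : μ.map X = (gaussianReal 0 1).map (σ * ·) := by
    rw [hX.map_eq_gaussianReal, gaussianReal_map_const_mul,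
      variance_of_integral_eq_zero hX.aemeasurable h0, h2, h0]
    congr 1
    · simp
    · ext; simp [sq_nonneg]
  have h := lintegral_map' (μ := μ) (f := fun x : ℝ => ‖x‖ₑ ^ 4) (by fun_prop) hX.aemeasurable
  rw [← h, hm, lintegral_map (by fun_prop) (by fun_prop), gaussianFourthMoment,
    ← lintegral_const_mul _ (by fun_prop)]
  congr 1
  funext x
  rw [enorm_mul, mul_pow, ENNReal.ofReal_pow hσ, Real.enorm_of_nonneg hσ]

namespace IsFractionalBrownianMotion

variable {H : ℝ} {B : ℝ≥0 → Ω → ℝ}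

theorem integrable_mul (hB : IsFractionalBrownianMotion H μ B) (s t : ℝ≥0) :
    Integrable (fun ω => B s ω * B t ω) μ :=
  (hB.gaussian.hasGaussianLaw_eval s).memLp_two.integrable_mul
    (hB.gaussian.hasGaussianLaw_eval t).memLp_two

theorem integral_sub_sq (hB : IsFractionalBrownianMotion H μ B) (hH : 0 < H) (s t : ℝ≥0) :
    ∫ ω, (B s ω - B t ω) ^ 2 ∂μ = (|(s : ℝ) - t| ^ H) ^ 2 := by
  have e : (fun ω => (B s ω - B t ω) ^ 2) = fun ω =>
      (B s ω * B s ω - 2 * (B s ω * B t ω)) + B t ω * B t ω := by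
    funext ω; ring
  have i1 := hB.integrable_mul s s
  have i2 := (hB.integrable_mul s t).const_mul 2
  rw [e, integral_add (by exact i1.sub i2) (hB.integrable_mul t t), integral_sub i1 i2,
    integral_const_mul, hB.covariance, hB.covariance, hB.covariance, ← Real.rpow_natCast,
    ← Real.rpow_mul (abs_nonneg _), sub_self, sub_self, abs_zero,
    Real.zero_rpow (by positivity : 2 * H ≠ 0)]
  push_cast
  ring_nf

theorem lintegral_enorm_sub_pow_four (hB : IsFractionalBrownianMotion H μ B) (hH : 0 < H)
    (s t : ℝ≥0) : ∫⁻ ω, ‖B s ω - B t ω‖ₑ ^ 4 ∂μ =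
      ENNReal.ofReal ((|(s : ℝ) - t| ^ H) ^ 4) * gaussianFourthMoment := by
  refine lintegral_enorm_pow_four_of_hasGaussianLaw hB.gaussian.hasGaussianLaw_fun_sub ?_
    (by positivity) (hB.integral_sub_sq hH s t)
  rw [integral_sub (hB.gaussian.hasGaussianLaw_eval s).integrable
    (hB.gaussian.hasGaussianLaw_eval t).integrable, hB.centered, hB.centered, sub_zero]

theorem eval_zero (hB : IsFractionalBrownianMotion H μ B) (hH : 0 < H) :
    ∀ᵐ ω ∂μ, B 0 ω = 0 := by
  have h := hB.covariance 0 0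
  simp only [NNReal.coe_zero, sub_self, abs_zero, Real.zero_rpow (by positivity : 2 * H ≠ 0)] at h
  norm_num at h
  rw [integral_eq_zero_iff_of_nonneg (fun ω => mul_self_nonneg _) (hB.integrable_mul 0 0)] at h
  filter_upwards [h] with ω hω
  simpa using hω

/-- The weighted sum of the fourth powers of all dyadic increments is almost surely finite; the
interval `[j 2⁻ᵏ, (j + 1) 2⁻ᵏ]` with `j = n 2ᵏ + i`, `i < 2ᵏ`, lies in `[n, n + 1]`. -/
theorem ae_tsum_dyadic_lt_top (hB : IsFractionalBrownianMotion H μ B) (hH : 0 < H) {θ γ : ℝ}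
    (hθ : 1 / 4 < θ) (hγ : γ < H - 1 / 4) :
    ∀ᵐ ω ∂μ, ∑' k : ℕ, ∑' n : ℕ, ∑ i ∈ Finset.range (2 ^ k),
      ENNReal.ofReal ((2 ^ (4 * γ)) ^ k * ((n + 1 : ℕ) : ℝ) ^ (-(4 * θ))) *
        ‖B ((n * 2 ^ k + i + 1 : ℕ) / 2 ^ k) ω - B ((n * 2 ^ k + i : ℕ) / 2 ^ k) ω‖ₑ ^ 4 < ∞ := by
  have hBm (t : ℝ≥0) : AEMeasurable (B t) μ := hB.gaussian.aemeasurable t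
  have hm (k n i : ℕ) : AEMeasurable (fun ω =>
      ENNReal.ofReal ((2 ^ (4 * γ)) ^ k * ((n + 1 : ℕ) : ℝ) ^ (-(4 * θ))) *
        ‖B ((n * 2 ^ k + i + 1 : ℕ) / 2 ^ k) ω - B ((n * 2 ^ k + i : ℕ) / 2 ^ k) ω‖ₑ ^ 4) μ :=
    (((hBm _).sub (hBm _)).enorm.pow_const 4).const_mul _
  have hm2 (k n : ℕ) := Finset.aemeasurable_fun_sum (Finset.range (2 ^ k)) fun i _ => hm k n i
  have hm3 (k : ℕ) : AEMeasurable (fun ω => ∑' n : ℕ, ∑ i ∈ Finset.range (2 ^ k),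
      ENNReal.ofReal ((2 ^ (4 * γ)) ^ k * ((n + 1 : ℕ) : ℝ) ^ (-(4 * θ))) *
        ‖B ((n * 2 ^ k + i + 1 : ℕ) / 2 ^ k) ω - B ((n * 2 ^ k + i : ℕ) / 2 ^ k) ω‖ₑ ^ 4) μ :=
    AEMeasurable.tsum (hm2 k)
  refine ae_lt_top' (AEMeasurable.tsum hm3) (ne_of_lt ?_)
  rw [lintegral_tsum hm3]
  have hterm (k n i : ℕ) : ∫⁻ ω, ENNReal.ofReal ((2 ^ (4 * γ)) ^ k *
      ((n + 1 : ℕ) : ℝ) ^ (-(4 * θ))) *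
        ‖B ((n * 2 ^ k + i + 1 : ℕ) / 2 ^ k) ω - B ((n * 2 ^ k + i : ℕ) / 2 ^ k) ω‖ₑ ^ 4 ∂μ =
      ENNReal.ofReal ((2 ^ (4 * γ)) ^ k * ((n + 1 : ℕ) : ℝ) ^ (-(4 * θ))) *
        (ENNReal.ofReal ((2 ^ (-(4 * H))) ^ k) * gaussianFourthMoment) := by
    rw [lintegral_const_mul'' _ (by exact ((hBm _).sub (hBm _)).enorm.pow_const 4),
      hB.lintegral_enorm_sub_pow_four hH]
    congr 3
    push_cast
    rw [← sub_div, add_sub_cancel_left, abs_of_pos (by positivity), one_div, ← inv_pow,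
      ← Real.rpow_natCast, ← Real.rpow_natCast, ← Real.rpow_natCast,
      ← Real.rpow_mul (by positivity), ← Real.rpow_mul (by positivity),
      ← Real.rpow_mul (by positivity), Real.inv_rpow (by positivity),
      ← Real.rpow_neg (by positivity)]
    congr 1
    push_cast
    ring
  set r : ℝ := 2 ^ (1 + 4 * γ - 4 * H) with hr
  have hr1 : r < 1 := Real.rpow_lt_one_of_one_lt_of_neg (by norm_num) (by linarith)
  have hrpow (k : ℕ) : 2 ^ k * ((2 ^ (4 * γ)) ^ k * (2 ^ (-(4 * H))) ^ k) = r ^ k := by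
    rw [← mul_pow, ← mul_pow, hr]
    congr 1
    rw [sub_eq_add_neg, Real.rpow_add (by norm_num), Real.rpow_add (by norm_num), Real.rpow_one]
    ring
  have hk (k : ℕ) : ∫⁻ ω, ∑' n : ℕ, ∑ i ∈ Finset.range (2 ^ k),
      ENNReal.ofReal ((2 ^ (4 * γ)) ^ k * ((n + 1 : ℕ) : ℝ) ^ (-(4 * θ))) *
        ‖B ((n * 2 ^ k + i + 1 : ℕ) / 2 ^ k) ω - B ((n * 2 ^ k + i : ℕ) / 2 ^ k) ω‖ₑ ^ 4 ∂μ =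
      ENNReal.ofReal (r ^ k) * ((∑' n : ℕ, ENNReal.ofReal (((n + 1 : ℕ) : ℝ) ^ (-(4 * θ)))) *
        gaussianFourthMoment) := by
    rw [lintegral_tsum (hm2 k), ← ENNReal.tsum_mul_right, ← ENNReal.tsum_mul_left]
    congr 1
    funext n
    rw [lintegral_finsetSum' _ fun i _ => hm k n i]
    simp_rw [hterm]
    rw [Finset.sum_const, Finset.card_range, nsmul_eq_mul, ← hrpow,
      ENNReal.ofReal_mul (by positivity), ENNReal.ofReal_mul (by positivity),
      ENNReal.ofReal_mul (by positivity), ENNReal.ofReal_pow (by norm_num : (0 : ℝ) ≤ 2)]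
    simp only [ENNReal.ofReal_ofNat]
    push_cast
    ring
  simp_rw [hk]
  rw [ENNReal.tsum_mul_right]
  have s1 : Summable fun k : ℕ => r ^ k := summable_geometric_of_lt_one (by positivity) hr1
  have s2 : Summable fun n : ℕ => ((n + 1 : ℕ) : ℝ) ^ (-(4 * θ)) :=
    (summable_nat_add_iff 1).2 (Real.summable_nat_rpow.2 (by linarith))
  exact ENNReal.mul_lt_top s1.tsum_ofReal_lt_top
    (ENNReal.mul_lt_top s2.tsum_ofReal_lt_top gaussianFourthMoment_lt_top)

/-- Almost every path of fractional Brownian motion is locally Hölder continuous, with a constant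
of polynomial growth. -/
theorem ae_exists_hasPolynomialModulus (hB : IsFractionalBrownianMotion H μ B) (hH : 0 < H)
    {θ γ : ℝ} (hθ : 1 / 4 < θ) (hγ0 : 0 < γ) (hγ : γ < H - 1 / 4) :
    ∀ᵐ ω ∂μ, ∃ C, 0 ≤ C ∧ HasPolynomialModulus θ γ C fun t => B t.toNNReal ω := by
  filter_upwards [hB.ae_tsum_dyadic_lt_top hH hθ hγ, hB.continuous_paths] with ω hS hc
  set S := ∑' k : ℕ, ∑' n : ℕ, ∑ i ∈ Finset.range (2 ^ k),
      ENNReal.ofReal ((2 ^ (4 * γ)) ^ k * ((n + 1 : ℕ) : ℝ) ^ (-(4 * θ))) *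
        ‖B ((n * 2 ^ k + i + 1 : ℕ) / 2 ^ k) ω - B ((n * 2 ^ k + i : ℕ) / 2 ^ k) ω‖ₑ ^ 4 with hSdef
  refine exists_hasPolynomialModulus_of_dyadic (A := (S.toReal) ^ (1 / 4 : ℝ))
    (hc.comp continuous_real_toNNReal) (by linarith) hγ0 (by positivity) fun k j => ?_
  have hcoe (j : ℕ) : ((j : ℝ) / 2 ^ k).toNNReal = (j : ℝ≥0) / 2 ^ k := by
    rw [Real.toNNReal_div (by positivity), Real.toNNReal_natCast, Real.toNNReal_pow (by norm_num)]
    simp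
  simp only [Function.comp_apply, hcoe]
  set n := j / 2 ^ k with hn
  set i := j % 2 ^ k with hi
  have hj : n * 2 ^ k + i = j := Nat.div_add_mod' j (2 ^ k)
  set d := B ((j + 1 : ℕ) / 2 ^ k) ω - B ((j : ℕ) / 2 ^ k) ω with hd
  have hle : ENNReal.ofReal ((2 ^ (4 * γ)) ^ k * ((n + 1 : ℕ) : ℝ) ^ (-(4 * θ))) * ‖d‖ₑ ^ 4 ≤ S := by
    refine le_trans ?_ (ENNReal.le_tsum k)
    refine le_trans ?_ (ENNReal.le_tsum n)
    have := Finset.single_le_sum (f := fun i =>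
      ENNReal.ofReal ((2 ^ (4 * γ)) ^ k * ((n + 1 : ℕ) : ℝ) ^ (-(4 * θ))) *
        ‖B ((n * 2 ^ k + i + 1 : ℕ) / 2 ^ k) ω - B ((n * 2 ^ k + i : ℕ) / 2 ^ k) ω‖ₑ ^ 4)
      (fun _ _ => zero_le) (Finset.mem_range.2 (Nat.mod_lt j (by positivity : 0 < 2 ^ k)))
    simpa only [← hi, hj] using this
  have hle' : (2 ^ (4 * γ)) ^ k * ((n + 1 : ℕ) : ℝ) ^ (-(4 * θ)) * |d| ^ 4 ≤ S.toReal := by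
    have := ENNReal.toReal_mono hS.ne hle
    rwa [ENNReal.toReal_mul, ENNReal.toReal_ofReal (by positivity), ENNReal.toReal_pow,
      toReal_enorm, Real.norm_eq_abs] at this
  have hn1 : ((n + 1 : ℕ) : ℝ) ≤ 1 + j / 2 ^ k := by
    have : (n : ℝ) ≤ j / 2 ^ k := by simpa using Nat.cast_div_le (α := ℝ) (m := j) (n := 2 ^ k)
    push_cast; linarith
  have hn0 : (0 : ℝ) < ((n + 1 : ℕ) : ℝ) := by positivity
  have hpow : (2 ^ (4 * γ)) ^ k * ((n + 1 : ℕ) : ℝ) ^ (-(4 * θ)) * |d| ^ 4 =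
      ((((1 / 2 : ℝ) ^ γ) ^ k * ((n + 1 : ℕ) : ℝ) ^ θ)⁻¹ * |d|) ^ 4 := by
    have e1 : ((2 : ℝ) ^ (4 * γ)) = (((1 / 2 : ℝ) ^ γ)⁻¹) ^ 4 := by
      rw [one_div, Real.inv_rpow (by norm_num), inv_inv, ← Real.rpow_natCast,
        ← Real.rpow_mul (by norm_num)]
      congr 1; push_cast; ring
    have e2 : ((n + 1 : ℕ) : ℝ) ^ (-(4 * θ)) = ((((n + 1 : ℕ) : ℝ) ^ θ)⁻¹) ^ 4 := by
      rw [Real.rpow_neg hn0.le, inv_pow, ← Real.rpow_natCast, ← Real.rpow_mul hn0.le]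
      congr 2; push_cast; ring
    rw [e1, e2, mul_inv, mul_pow, mul_pow, ← pow_mul, ← inv_pow, ← pow_mul, mul_comm 4 k]
  rw [hpow] at hle'
  have hroot : (((1 / 2 : ℝ) ^ γ) ^ k * ((n + 1 : ℕ) : ℝ) ^ θ)⁻¹ * |d| ≤ S.toReal ^ (1 / 4 : ℝ) := by
    have h4 : (1 / 4 : ℝ) = ((4 : ℕ) : ℝ)⁻¹ := by norm_num
    rw [h4, ← Real.pow_rpow_inv_natCast (n := 4) (x := _ * |d|) (by positivity) (by norm_num)]
    gcongr
  have hP : 0 < ((1 / 2 : ℝ) ^ γ) ^ k * ((n + 1 : ℕ) : ℝ) ^ θ := by positivity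
  rw [inv_mul_le_iff₀ hP] at hroot
  calc |d| ≤ ((1 / 2 : ℝ) ^ γ) ^ k * ((n + 1 : ℕ) : ℝ) ^ θ * S.toReal ^ (1 / 4 : ℝ) := hroot
    _ ≤ ((1 / 2 : ℝ) ^ γ) ^ k * (1 + j / 2 ^ k) ^ θ * S.toReal ^ (1 / 4 : ℝ) := by
      gcongr
    _ = _ := by ring

end IsFractionalBrownianMotion

/-- A process with almost surely continuous paths on `[0, ∞)` is indistinguishable from one all of
whose paths are continuous and all of whose coordinates are measurable. -/
theorem exists_measurable_continuous_modification {B : ℝ≥0 → Ω → ℝ}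
    (hm : ∀ t, AEMeasurable (B t) μ) (hc : ∀ᵐ ω ∂μ, Continuous fun t => B t ω) :
    ∃ B' : ℝ≥0 → Ω → ℝ, (∀ t, Measurable (B' t)) ∧ (∀ ω, Continuous fun t => B' t ω) ∧
      ∀ᵐ ω ∂μ, ∀ t, B' t ω = B t ω := by
  classical
  set d := TopologicalSpace.denseSeq ℝ≥0 with hd
  have hE : ∀ᵐ ω ∂μ, (Continuous fun t => B t ω) ∧ ∀ n, B (d n) ω = (hm (d n)).mk _ ω :=
    hc.and (ae_all_iff.2 fun n => (hm (d n)).ae_eq_mk)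
  obtain ⟨N, hN, hNm, hN0⟩ := exists_measurable_superset_of_null hE
  have hgood (ω : Ω) (hω : ω ∉ N) : (Continuous fun t => B t ω) ∧
      ∀ n, B (d n) ω = (hm (d n)).mk _ ω := by
    by_contra hcon
    exact hω (hN hcon)
  set B' : ℝ≥0 → Ω → ℝ := fun t ω => if ω ∈ N then 0 else B t ω with hB'
  have hcont (ω : Ω) : Continuous fun t => B' t ω := by
    by_cases hω : ω ∈ N
    · simpa [hB', hω] using continuous_const
    · simpa [hB', hω] using (hgood ω hω).1
  have hmd (n : ℕ) : Measurable (B' (d n)) := by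
    have : B' (d n) = fun ω => if ω ∈ N then 0 else (hm (d n)).mk _ ω := by
      funext ω
      by_cases hω : ω ∈ N
      · simp [hB', hω]
      · simp [hB', hω, (hgood ω hω).2 n]
    rw [this]
    exact Measurable.ite hNm measurable_const (hm (d n)).measurable_mk
  refine ⟨B', fun t => ?_, hcont, ?_⟩
  · obtain ⟨u, hu, hut⟩ := mem_closure_iff_seq_limit.1
      ((TopologicalSpace.denseRange_denseSeq ℝ≥0) t)
    refine measurable_of_tendsto_metrizable (f := fun n => B' (u n)) (fun n => ?_)
      (tendsto_pi_nhds.2 fun ω => ((hcont ω).tendsto t).comp hut)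
    obtain ⟨m, hm'⟩ := hu n
    simp only [← hm']
    exact hmd m
  · filter_upwards [measure_eq_zero_iff_ae_notMem.1 hN0] with ω hω t
    simp [hB', hω]

end

/-! ### The covariance as a double integral, and mixtures of step functions -/

/-- The covariance function of fractional Brownian motion. -/
def fbmCovariance (H u v : ℝ) : ℝ := (u ^ (2 * H) + v ^ (2 * H) - |u - v| ^ (2 * H)) / 2

theorem intervalIntegrable_abs_rpow {p : ℝ} (hp : -1 < p) (c d : ℝ) :
    IntervalIntegrable (fun x : ℝ => |x| ^ p) volume c d := by
  have hpos (c : ℝ) (hc : 0 ≤ c) : IntervalIntegrable (fun x : ℝ => |x| ^ p) volume 0 c :=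
    (intervalIntegral.intervalIntegrable_rpow' hp).congr fun x hx => by
      rw [uIoc_of_le hc] at hx
      simp only [abs_of_pos hx.1]
  have h (c : ℝ) : IntervalIntegrable (fun x : ℝ => |x| ^ p) volume 0 c := by
    rcases le_total 0 c with hc | hc
    · exact hpos c hc
    · have h1 := (IntervalIntegrable.iff_comp_neg).1 (hpos (-c) (by linarith))
      simpa using h1
  exact (h c).symm.trans (h d)

theorem integral_abs_rpow {p : ℝ} (hp : -1 < p) (c : ℝ) :
    ∫ x in (0 : ℝ)..c, |x| ^ p = |c| ^ p * c / (p + 1) := by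
  have hp1 : p + 1 ≠ 0 := by linarith
  have hpos (c : ℝ) (hc : 0 ≤ c) : ∫ x in (0 : ℝ)..c, |x| ^ p = c ^ (p + 1) / (p + 1) := by
    have h1 : ∫ x in (0 : ℝ)..c, |x| ^ p = ∫ x in (0 : ℝ)..c, x ^ p := by
      refine intervalIntegral.integral_congr fun x hx => ?_
      rw [uIcc_of_le hc] at hx
      simp only [abs_of_nonneg hx.1]
    rw [h1, integral_rpow (Or.inl hp), Real.zero_rpow hp1, sub_zero]
  have hcase (c : ℝ) (hc : 0 ≤ c) : c ^ (p + 1) = |c| ^ p * c := by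
    rcases hc.eq_or_lt with rfl | hc
    · simp [Real.zero_rpow hp1]
    · rw [abs_of_pos hc, Real.rpow_add hc, Real.rpow_one]
  rcases le_total 0 c with hc | hc
  · rw [hpos c hc, hcase c hc]
  · have h1 : ∫ x in (0 : ℝ)..c, |x| ^ p = -∫ x in (0 : ℝ)..(-c), |x| ^ p := by
      have h2 := intervalIntegral.integral_comp_neg (a := 0) (b := c) (fun x : ℝ => |x| ^ p)
      simp only [abs_neg, neg_zero] at h2
      rw [h2, intervalIntegral.integral_symm]
    rw [h1, hpos (-c) (by linarith), hcase (-c) (by linarith), abs_neg]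
    ring

theorem fbmKernel_nonneg {H : ℝ} (hH : 1 / 2 < H) (s t : ℝ) : 0 ≤ fbmKernel H s t := by
  unfold fbmKernel
  have : 0 ≤ 2 * H - 1 := by linarith
  have : 0 ≤ H := by linarith
  positivity

theorem measurable_fbmKernel (H : ℝ) : Measurable fun z : ℝ × ℝ => fbmKernel H z.1 z.2 := by
  unfold fbmKernel
  fun_prop

theorem intervalIntegrable_fbmKernel {H : ℝ} (hH : 1 / 2 < H) (s v : ℝ) :
    IntervalIntegrable (fbmKernel H s) volume 0 v := by
  unfold fbmKernel
  have h1 := ((intervalIntegrable_abs_rpow (p := 2 * H - 2) (by linarith)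
    (s - 0) (s - v)).comp_sub_left s).const_mul (H * (2 * H - 1))
  simpa using h1

theorem integral_fbmKernel {H : ℝ} (hH : 1 / 2 < H) (s v : ℝ) :
    ∫ t in (0 : ℝ)..v, fbmKernel H s t =
      H * (|s| ^ (2 * H - 2) * s - |s - v| ^ (2 * H - 2) * (s - v)) := by
  have hp : -1 < 2 * H - 2 := by linarith
  unfold fbmKernel
  rw [intervalIntegral.integral_const_mul,
    intervalIntegral.integral_comp_sub_left (fun x => |x| ^ (2 * H - 2)), sub_zero,
    ← intervalIntegral.integral_interval_sub_left (intervalIntegrable_abs_rpow hp 0 _)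
      (intervalIntegrable_abs_rpow hp 0 _), integral_abs_rpow hp, integral_abs_rpow hp]
  have : 2 * H - 1 ≠ 0 := by linarith
  rw [show 2 * H - 2 + 1 = 2 * H - 1 by ring, ← sub_div]
  generalize 2 * H - 1 = c at this
  field_simp

theorem hasDerivAt_abs_rpow_sub {H : ℝ} (hH : 1 / 2 < H) (v s : ℝ) :
    HasDerivAt (fun s => (|s| ^ (2 * H) - |s - v| ^ (2 * H)) / 2)
      (H * (|s| ^ (2 * H - 2) * s - |s - v| ^ (2 * H - 2) * (s - v))) s := by
  have h1 := hasDerivAt_abs_rpow s (p := 2 * H) (by linarith)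
  have h2 := (hasDerivAt_abs_rpow (s - v) (p := 2 * H) (by linarith)).comp s
    ((hasDerivAt_id' s).sub_const v)
  refine ((h1.sub h2).div_const 2).congr_deriv ?_
  ring

theorem integral_integral_fbmKernel {H : ℝ} (hH : 1 / 2 < H) {u v : ℝ} (hu : 0 ≤ u) (hv : 0 ≤ v) :
    ∫ s in (0 : ℝ)..u, ∫ t in (0 : ℝ)..v, fbmKernel H s t = fbmCovariance H u v := by
  simp_rw [integral_fbmKernel hH]
  have hc (c : ℝ) : Continuous fun s : ℝ => |s - c| ^ (2 * H - 2) * (s - c) := by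
    have h : (fun s : ℝ => |s - c| ^ (2 * H - 2) * (s - c)) =
        fun s => (∫ x in (0 : ℝ)..(s - c), |x| ^ (2 * H - 2)) * (2 * H - 1) := by
      funext s
      rw [integral_abs_rpow (by linarith)]
      have : 2 * H - 1 ≠ 0 := by linarith
      rw [show 2 * H - 2 + 1 = 2 * H - 1 by ring]
      field_simp
    rw [h]
    exact ((intervalIntegral.continuous_primitive
      (fun a b => intervalIntegrable_abs_rpow (by linarith) a b) 0).comp
        (continuous_sub_right c)).mul continuous_const
  have hc0 : Continuous fun s : ℝ => |s| ^ (2 * H - 2) * s := by simpa using hc 0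
  rw [intervalIntegral.integral_eq_sub_of_hasDerivAt
    (fun s _ => hasDerivAt_abs_rpow_sub hH v s)
    (((hc0.sub (hc v)).const_mul H).intervalIntegrable _ _), fbmCovariance]
  have : 2 * H ≠ 0 := by linarith
  rw [abs_of_nonneg hu, zero_sub, abs_neg, abs_of_nonneg hv, abs_zero, Real.zero_rpow this]
  ring

/-- The kernel `φ` is a density of the covariance: `∫₀ᵘ ∫₀ᵛ φ = R(u, v)`. -/
theorem integrable_and_integral_indicator_mul_fbmKernel {H : ℝ} (hH : 1 / 2 < H) {u v : ℝ}
    (hu : 0 ≤ u) (hv : 0 ≤ v) :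
    Integrable (fun z : ℝ × ℝ => (Ioc 0 u).indicator (1 : ℝ → ℝ) z.1 *
      (Ioc 0 v).indicator (1 : ℝ → ℝ) z.2 * fbmKernel H z.1 z.2) quadrantMeasure ∧
    ∫ z : ℝ × ℝ, (Ioc 0 u).indicator (1 : ℝ → ℝ) z.1 *
      (Ioc 0 v).indicator (1 : ℝ → ℝ) z.2 * fbmKernel H z.1 z.2 ∂quadrantMeasure =
      fbmCovariance H u v := by
  have hind (c : ℝ) (q : ℝ → ℝ) : (fun t => (Ioc 0 c).indicator (1 : ℝ → ℝ) t * q t) =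
      (Ioc 0 c).indicator q := by
    funext t
    by_cases ht : t ∈ Ioc 0 c <;> simp [ht]
  have hindi (c : ℝ) (q : ℝ → ℝ) (hc : 0 ≤ c) : ∫ t in Ioi 0, (Ioc 0 c).indicator q t =
      ∫ t in (0 : ℝ)..c, q t := by
    rw [intervalIntegral.integral_of_le hc, setIntegral_indicator measurableSet_Ioc,
      inter_eq_right.2 Ioc_subset_Ioi_self]
  have hindint (c : ℝ) (q : ℝ → ℝ) (hc : 0 ≤ c) (hq : IntervalIntegrable q volume 0 c) :
      IntegrableOn ((Ioc 0 c).indicator q) (Ioi 0) := by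
    rw [intervalIntegrable_iff_integrableOn_Ioc_of_le hc] at hq
    exact ((integrable_indicator_iff measurableSet_Ioc).2 hq).integrableOn
  have hmeas (c : ℝ) : Measurable ((Ioc 0 c).indicator (1 : ℝ → ℝ)) :=
    measurable_one.indicator measurableSet_Ioc
  set F : ℝ × ℝ → ℝ := fun z => (Ioc 0 u).indicator (1 : ℝ → ℝ) z.1 *
      (Ioc 0 v).indicator (1 : ℝ → ℝ) z.2 * fbmKernel H z.1 z.2 with hF
  have hFm : Measurable F :=
    (((hmeas u).comp measurable_fst).mul ((hmeas v).comp measurable_snd)).mul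
      (measurable_fbmKernel H)
  have hF0 (z : ℝ × ℝ) : 0 ≤ F z := by
    refine mul_nonneg (mul_nonneg ?_ ?_) (fbmKernel_nonneg hH _ _) <;>
      exact indicator_nonneg (fun _ _ => zero_le_one) _
  have hsec (s : ℝ) : (fun t => F (s, t)) = fun t => (Ioc 0 u).indicator (1 : ℝ → ℝ) s *
      (Ioc 0 v).indicator (fbmKernel H s) t := by
    funext t
    simp only [hF]
    rw [mul_assoc, congrFun (hind v (fbmKernel H s)) t]
  have hsecint (s : ℝ) : ∫ t in Ioi 0, F (s, t) =
      (Ioc 0 u).indicator (fun s => ∫ t in (0 : ℝ)..v, fbmKernel H s t) s := by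
    rw [hsec, integral_const_mul, hindi v _ hv,
      congrFun (hind u fun s => ∫ t in (0 : ℝ)..v, fbmKernel H s t) s]
  have hinner : IntervalIntegrable (fun s => ∫ t in (0 : ℝ)..v, fbmKernel H s t) volume 0 u := by
    have hnn : ∀ s ∈ Ioo 0 u, 0 ≤ ∫ t in (0 : ℝ)..v, fbmKernel H s t := fun s _ =>
      intervalIntegral.integral_nonneg hv fun t _ => fbmKernel_nonneg hH _ _
    rw [intervalIntegrable_iff_integrableOn_Ioc_of_le hu]
    refine intervalIntegral.integrableOn_deriv_of_nonneg
      (g := fun s => (|s| ^ (2 * H) - |s - v| ^ (2 * H)) / 2)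
      (fun s _ => (hasDerivAt_abs_rpow_sub hH v s).continuousAt.continuousWithinAt)
      (fun s _ => ?_) hnn
    rw [integral_fbmKernel hH]
    exact hasDerivAt_abs_rpow_sub hH v s
  have hint : Integrable F quadrantMeasure := by
    refine (integrable_prod_iff hFm.aestronglyMeasurable).2 ⟨Eventually.of_forall fun s => ?_, ?_⟩
    · rw [hsec]
      exact (hindint v _ hv (intervalIntegrable_fbmKernel hH s v)).const_mul _
    · simp_rw [Real.norm_of_nonneg (hF0 _), hsecint]
      exact hindint u _ hu hinner
  refine ⟨hint, ?_⟩
  unfold quadrantMeasure at hint ⊢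
  rw [integral_prod _ hint]
  simp_rw [hsecint]
  rw [hindi u _ hu, integral_integral_fbmKernel hH hu hv]

/-- The Fubini step common to both sides of the isometry: for a mixture with weight `w` of a family
`G (x, y)` whose `L¹` norms are at most `β x * β y`, the mixture may be integrated termwise. -/
theorem integrable_and_integral_bilinear_mixture {α Θ : Type*} [MeasurableSpace α]
    [MeasurableSpace Θ] {ρ : Measure α} [SFinite ρ] {κ : Measure Θ} [SFinite κ] {w β : α → ℝ}
    (hw : Measurable w) (hβ : Integrable (fun x => w x * β x) ρ) {G : α × α → Θ → ℝ}
    (hG : Measurable (Function.uncurry G)) (hGi : ∀ z, Integrable (G z) κ)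
    (hbound : ∀ z, ∫ θ, |G z θ| ∂κ ≤ β z.1 * β z.2) :
    Integrable (fun θ => ∫ z, w z.1 * w z.2 * G z θ ∂(ρ.prod ρ)) κ ∧
      ∫ θ, ∫ z, w z.1 * w z.2 * G z θ ∂(ρ.prod ρ) ∂κ =
        ∫ z, w z.1 * w z.2 * ∫ θ, G z θ ∂κ ∂(ρ.prod ρ) := by
  have hm : Measurable fun q : (α × α) × Θ => w q.1.1 * w q.1.2 * G q.1 q.2 :=
    ((hw.comp (measurable_fst.comp measurable_fst)).mul
      (hw.comp (measurable_snd.comp measurable_fst))).mul hG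
  have hint : Integrable (fun q : (α × α) × Θ => w q.1.1 * w q.1.2 * G q.1 q.2)
      ((ρ.prod ρ).prod κ) := by
    refine (integrable_prod_iff hm.aestronglyMeasurable).2
      ⟨Eventually.of_forall fun z => (hGi z).const_mul (w z.1 * w z.2), ?_⟩
    refine Integrable.mono' (hβ.norm.mul_prod hβ.norm)
      hm.aestronglyMeasurable.norm.integral_prod_right' (Eventually.of_forall fun z => ?_)
    rw [Real.norm_of_nonneg (integral_nonneg fun _ => norm_nonneg _)]
    simp_rw [norm_mul, integral_const_mul, Real.norm_eq_abs]
    calc |w z.1| * |w z.2| * ∫ θ, |G z θ| ∂κ ≤ |w z.1| * |w z.2| * |β z.1 * β z.2| := by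
          gcongr
          exact (hbound z).trans (le_abs_self _)
      _ = _ := by rw [abs_mul]; ring
  refine ⟨hint.integral_prod_right, ?_⟩
  rw [integral_integral_swap (f := fun θ z => w z.1 * w z.2 * G z θ) hint.swap]
  simp_rw [integral_const_mul]

theorem fbmCovariance_le {H u v : ℝ} (hu : 0 ≤ u) (hv : 0 ≤ v) :
    fbmCovariance H u v ≤ (1 + u ^ (2 * H)) * (1 + v ^ (2 * H)) := by
  have h1 := Real.rpow_nonneg hu (2 * H)
  have h2 := Real.rpow_nonneg hv (2 * H)
  have h3 := Real.rpow_nonneg (abs_nonneg (u - v)) (2 * H)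
  unfold fbmCovariance
  nlinarith [mul_nonneg h1 h2]

section

variable {α : Type*} [MeasurableSpace α] {ρ : Measure α} [SFinite ρ] {w : α → ℝ} {τ : α → ℝ≥0}
  {H : ℝ}

/-- The norm in `L²_φ` of the mixture `s ↦ ∫ w(x) 1_{(0, τ x]}(s) dρ(x)` of step functions. -/
theorem integrable_and_phiNormSq_mixture (hH : 1 / 2 < H) (hw : Measurable w) (hτ : Measurable τ)
    (hwτ : Integrable (fun x => w x * (1 + (τ x : ℝ) ^ (2 * H))) ρ) {f : ℝ → ℝ}
    (hf : ∀ s, 0 < s → f s = ∫ x, w x * (Ioc 0 (τ x : ℝ)).indicator (1 : ℝ → ℝ) s ∂ρ) :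
    Integrable (fun z : ℝ × ℝ => f z.1 * f z.2 * fbmKernel H z.1 z.2) quadrantMeasure ∧
    phiNormSq H f = ∫ z, w z.1 * w z.2 * fbmCovariance H (τ z.1) (τ z.2) ∂(ρ.prod ρ) := by
  set G : α × α → ℝ × ℝ → ℝ := fun z θ => (Ioc 0 (τ z.1 : ℝ)).indicator (1 : ℝ → ℝ) θ.1 *
      (Ioc 0 (τ z.2 : ℝ)).indicator (1 : ℝ → ℝ) θ.2 * fbmKernel H θ.1 θ.2 with hG
  have hG0 (z : α × α) (θ : ℝ × ℝ) : 0 ≤ G z θ := by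
    refine mul_nonneg (mul_nonneg ?_ ?_) (fbmKernel_nonneg hH _ _) <;>
      exact indicator_nonneg (fun _ _ => zero_le_one) _
  have hind : Measurable fun q : ℝ≥0 × ℝ => (Ioc 0 (q.1 : ℝ)).indicator (1 : ℝ → ℝ) q.2 := by
    have : (fun q : ℝ≥0 × ℝ => (Ioc 0 (q.1 : ℝ)).indicator (1 : ℝ → ℝ) q.2) =
        {q : ℝ≥0 × ℝ | 0 < q.2 ∧ q.2 ≤ q.1}.indicator 1 := by
      funext q
      simp [indicator_apply]
    rw [this]
    exact measurable_one.indicator ((measurableSet_lt measurable_const measurable_snd).inter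
      (measurableSet_le measurable_snd (measurable_fst.coe_nnreal_real)))
  have hGm : Measurable (Function.uncurry G) := by
    refine ((hind.comp (f := fun q : (α × α) × (ℝ × ℝ) => (τ q.1.1, q.2.1)) (by fun_prop)).mul
      (hind.comp (f := fun q : (α × α) × (ℝ × ℝ) => (τ q.1.2, q.2.2)) (by fun_prop))).mul
      ((measurable_fbmKernel H).comp measurable_snd)
  have hGI (z : α × α) := integrable_and_integral_indicator_mul_fbmKernel hH
    (τ z.1).coe_nonneg (τ z.2).coe_nonneg
  have hsf : SFinite quadrantMeasure := by unfold quadrantMeasure; infer_instance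
  have hmix := integrable_and_integral_bilinear_mixture (κ := quadrantMeasure) hw hwτ hGm
    (fun z => (hGI z).1) (fun z => by
      simp_rw [abs_of_nonneg (hG0 z _)]
      rw [(hGI z).2]
      exact fbmCovariance_le (τ z.1).coe_nonneg (τ z.2).coe_nonneg)
  have hae : (fun θ => ∫ z, w z.1 * w z.2 * G z θ ∂(ρ.prod ρ)) =ᵐ[quadrantMeasure]
      fun θ => f θ.1 * f θ.2 * fbmKernel H θ.1 θ.2 := by
    have hq : ∀ᵐ θ ∂quadrantMeasure, θ ∈ Ioi (0 : ℝ) ×ˢ Ioi (0 : ℝ) := by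
      unfold quadrantMeasure
      rw [Measure.prod_restrict]
      exact ae_restrict_mem (measurableSet_Ioi.prod measurableSet_Ioi)
    filter_upwards [hq] with θ hθ
    rw [hf _ hθ.1, hf _ hθ.2, ← integral_prod_mul, ← integral_mul_const]
    congr 1
    funext z
    simp only [hG]
    ring
  refine ⟨hmix.1.congr hae, ?_⟩
  rw [phiNormSq, ← integral_congr_ae hae, hmix.2]
  simp_rw [hG, (hGI _).2]

variable {Ω : Type*} [MeasurableSpace Ω] {μ : Measure Ω} {B : ℝ≥0 → Ω → ℝ}

/-- The second moment of the mixture `∫ w(x) B_{τ x} dρ(x)`. -/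
theorem memLp_and_integral_sq_mixture [SFinite μ] (hH : 1 / 2 < H)
    (hB : IsFractionalBrownianMotion H μ B)
    (hBm : Measurable (Function.uncurry B)) (hw : Measurable w) (hτ : Measurable τ)
    (hwτ : Integrable (fun x => w x * (1 + (τ x : ℝ) ^ (2 * H))) ρ) :
    MemLp (fun ω => ∫ x, w x * B (τ x) ω ∂ρ) 2 μ ∧
    ∫ ω, (∫ x, w x * B (τ x) ω ∂ρ) ^ 2 ∂μ =
      ∫ z, w z.1 * w z.2 * fbmCovariance H (τ z.1) (τ z.2) ∂(ρ.prod ρ) := by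
  set G : α × α → Ω → ℝ := fun z ω => B (τ z.1) ω * B (τ z.2) ω with hG
  have hGm : Measurable (Function.uncurry G) :=
    (hBm.comp (f := fun q : (α × α) × Ω => (τ q.1.1, q.2)) (by fun_prop)).mul
      (hBm.comp (f := fun q : (α × α) × Ω => (τ q.1.2, q.2)) (by fun_prop))
  have hvar (t : ℝ≥0) : ∫ ω, B t ω * B t ω ∂μ = (t : ℝ) ^ (2 * H) := by
    rw [hB.covariance, sub_self, abs_zero, Real.zero_rpow (by linarith)]
    ring
  have hbound (z : α × α) : ∫ ω, |G z ω| ∂μ ≤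
      (1 + (τ z.1 : ℝ) ^ (2 * H)) * (1 + (τ z.2 : ℝ) ^ (2 * H)) := by
    have i1 := hB.integrable_mul (τ z.1) (τ z.1)
    have i2 := hB.integrable_mul (τ z.2) (τ z.2)
    have h1 : ∫ ω, |G z ω| ∂μ ≤
        ∫ ω, (B (τ z.1) ω * B (τ z.1) ω + B (τ z.2) ω * B (τ z.2) ω) ∂μ := by
      refine integral_mono (hB.integrable_mul _ _).abs (i1.add i2) fun ω => ?_
      simp only [hG]
      rw [abs_mul]
      nlinarith [abs_mul_abs_self (B (τ z.1) ω), abs_mul_abs_self (B (τ z.2) ω),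
        sq_nonneg (|B (τ z.1) ω| - |B (τ z.2) ω|), abs_nonneg (B (τ z.1) ω),
        abs_nonneg (B (τ z.2) ω)]
    rw [integral_add i1 i2, hvar, hvar] at h1
    have h2 := Real.rpow_nonneg (τ z.1).coe_nonneg (2 * H)
    have h3 := Real.rpow_nonneg (τ z.2).coe_nonneg (2 * H)
    nlinarith [mul_nonneg h2 h3]
  have hmix := integrable_and_integral_bilinear_mixture (κ := μ) hw hwτ hGm
    (fun z => hB.integrable_mul _ _) hbound
  have hsq (ω : Ω) : ∫ z, w z.1 * w z.2 * G z ω ∂(ρ.prod ρ) = (∫ x, w x * B (τ x) ω ∂ρ) ^ 2 := by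
    rw [sq, ← integral_prod_mul]
    congr 1
    funext z
    simp only [hG]
    ring
  simp_rw [hsq] at hmix
  have hLm : StronglyMeasurable fun ω => ∫ x, w x * B (τ x) ω ∂ρ := by
    have : Measurable fun q : Ω × α => w q.2 * B (τ q.2) q.1 :=
      (hw.comp measurable_snd).mul
        (hBm.comp (f := fun q : Ω × α => (τ q.2, q.1)) (by fun_prop))
    exact this.stronglyMeasurable.integral_prod_right
  refine ⟨(memLp_two_iff_integrable_sq hLm.aestronglyMeasurable).2 hmix.1, ?_⟩
  rw [hmix.2]
  simp_rw [hG, hB.covariance, fbmCovariance]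

end

/-! ### The integral of the limit kernel -/

theorem measurable_stepFunction (p : ℝ≥0 →₀ ℝ) : Measurable (stepFunction p) := by
  unfold stepFunction Finsupp.sum
  exact Finset.measurable_fun_sum _ fun t _ =>
    (measurable_one.indicator measurableSet_Ioc).const_mul _

/-- Lebesgue measure on `(0, ∞)` with an additional atom at every jump of the step function
encoded by `p`. -/
def jumpMeasure (p : ℝ≥0 →₀ ℝ) : Measure ℝ :=
  volume.restrict (Ioi 0) + ∑ t ∈ p.support, Measure.dirac (t : ℝ)

/-- The weight for which `h - stepFunction p` is the `jumpMeasure p`-mixture of the functions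
`1_{(0, u]}`: the density `k = -h'` off the jumps, and minus the coefficient at a jump. -/
def jumpWeight (a : ℝ) (p : ℝ≥0 →₀ ℝ) (u : ℝ) : ℝ :=
  if u.toNNReal ∈ p.support then -p u.toNNReal else limitDensity a u

instance sFinite_jumpMeasure (p : ℝ≥0 →₀ ℝ) : SFinite (jumpMeasure p) := by
  unfold jumpMeasure
  infer_instance

theorem measurable_jumpWeight {a : ℝ} (ha : 0 < a) (p : ℝ≥0 →₀ ℝ) :
    Measurable (jumpWeight a p) := by
  have hp : Measurable p := by
    have : (p : ℝ≥0 → ℝ) = fun t =>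
        ∑ u ∈ p.support, ({u} : Set ℝ≥0).indicator (fun _ => p u) t := by
      funext t
      simp [indicator_apply, Finset.sum_ite_eq]
    rw [this]
    exact Finset.measurable_fun_sum _ fun u _ =>
      measurable_const.indicator (measurableSet_singleton u)
  unfold jumpWeight
  refine Measurable.ite ?_ (hp.comp measurable_real_toNNReal).neg
    (continuous_limitDensity ha).measurable
  exact measurable_real_toNNReal p.support.measurableSet

theorem integrable_and_integral_jumpWeight_mul {a : ℝ} (p : ℝ≥0 →₀ ℝ) {g : ℝ → ℝ}
    (hg : IntegrableOn (fun u => limitDensity a u * g u) (Ioi 0)) :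
    Integrable (fun u => jumpWeight a p u * g u) (jumpMeasure p) ∧
    ∫ u, jumpWeight a p u * g u ∂(jumpMeasure p) =
      (∫ u in Ioi 0, limitDensity a u * g u) - p.sum fun t c => c * g t := by
  have hae : (fun u => limitDensity a u * g u) =ᵐ[volume.restrict (Ioi 0)]
      fun u => jumpWeight a p u * g u := by
    have hfin : ((fun t : ℝ≥0 => (t : ℝ)) '' (p.support : Set ℝ≥0)).Finite :=
      p.support.finite_toSet.image _
    have hnull := measure_eq_zero_iff_ae_notMem.1
      (hfin.measure_zero (volume.restrict (Ioi (0 : ℝ))))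
    filter_upwards [hnull, ae_restrict_mem measurableSet_Ioi] with u hu hu0
    have : u.toNNReal ∉ p.support := fun hmem =>
      hu ⟨u.toNNReal, hmem, Real.coe_toNNReal u (le_of_lt hu0)⟩
    simp only [jumpWeight, if_neg this]
  have h1 : Integrable (fun u => jumpWeight a p u * g u) (volume.restrict (Ioi 0)) := hg.congr hae
  have hd (t : ℝ≥0) (_ : t ∈ p.support) :
      Integrable (fun u => jumpWeight a p u * g u) (Measure.dirac (t : ℝ)) :=
    integrable_dirac enorm_lt_top
  have h2 : Integrable (fun u => jumpWeight a p u * g u)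
      (∑ t ∈ p.support, Measure.dirac (t : ℝ)) :=
    integrable_finsetSum_measure.2 hd
  refine ⟨h1.add_measure h2, ?_⟩
  rw [jumpMeasure, integral_add_measure h1 h2, integral_finsetSum_measure hd,
    ← integral_congr_ae hae, sub_eq_add_neg, Finsupp.sum, ← Finset.sum_neg_distrib]
  congr 1
  refine Finset.sum_congr rfl fun t ht => ?_
  rw [integral_dirac, jumpWeight, Real.toNNReal_coe, if_pos ht, neg_mul]

theorem limitKernel_sub_stepFunction_eq {a : ℝ} (ha : 0 < a) (p : ℝ≥0 →₀ ℝ) {s : ℝ} (hs : 0 < s) :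
    limitKernel a s - stepFunction p s = ∫ u, jumpWeight a p u *
      (Ioc 0 (u.toNNReal : ℝ)).indicator (1 : ℝ → ℝ) s ∂(jumpMeasure p) := by
  have e : (fun u => limitDensity a u * (Ioc 0 (u.toNNReal : ℝ)).indicator (1 : ℝ → ℝ) s) =
      (Ici s).indicator (limitDensity a) := by
    funext u
    have : s ∈ Ioc 0 (u.toNNReal : ℝ) ↔ u ∈ Ici s := by
      simp only [mem_Ioc, mem_Ici, Real.coe_toNNReal', le_max_iff, hs, true_and]
      exact or_iff_left (not_le.2 hs)
    by_cases hu : u ∈ Ici s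
    · rw [indicator_of_mem (this.2 hu), indicator_of_mem hu, Pi.one_apply, mul_one]
    · rw [indicator_of_notMem (mt this.1 hu), indicator_of_notMem hu, mul_zero]
  have hi : IntegrableOn ((Ici s).indicator (limitDensity a)) (Ioi 0) :=
    (integrableOn_limitDensity ha).indicator measurableSet_Ici
  rw [(integrable_and_integral_jumpWeight_mul p (by rw [e]; exact hi)).2, e,
    setIntegral_indicator measurableSet_Ici,
    inter_eq_right.2 (show Ici s ⊆ Ioi 0 from fun u hu => hs.trans_le hu),
    integral_Ici_eq_integral_Ioi, ← limitKernel_eq_integral_Ioi ha hs.le, stepFunction]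
  simp only [Real.toNNReal_coe]

/-- The step function with values close to `h (j / N)` on `((j - 1) / N, j / N]` for
`1 ≤ j ≤ N ^ 2`, where `N = n + 1`, and `0` beyond; its coefficients are the decrements of `h`. -/
def approxStep (a : ℝ) (n : ℕ) : ℝ≥0 →₀ ℝ :=
  ∑ j ∈ Finset.range ((n + 1) ^ 2), Finsupp.single (((j + 1 : ℕ) : ℝ≥0) / (n + 1 : ℕ))
    (limitKernel a ((j + 1 : ℕ) / (n + 1 : ℕ)) - limitKernel a ((j + 2 : ℕ) / (n + 1 : ℕ)))

theorem stepFunction_approxStep (a : ℝ) (n : ℕ) {s : ℝ} (hs : 0 < s) :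
    stepFunction (approxStep a n) s = limitKernel a (⌈s * (n + 1 : ℕ)⌉₊ / (n + 1 : ℕ)) -
      limitKernel a ((max ⌈s * (n + 1 : ℕ)⌉₊ ((n + 1) ^ 2 + 1) : ℕ) / (n + 1 : ℕ)) := by
  have hN : (0 : ℝ) < (n + 1 : ℕ) := by positivity
  have hsum (M : ℕ) : stepFunction (∑ j ∈ Finset.range M, Finsupp.single
      (((j + 1 : ℕ) : ℝ≥0) / (n + 1 : ℕ)) (limitKernel a ((j + 1 : ℕ) / (n + 1 : ℕ)) -
        limitKernel a ((j + 2 : ℕ) / (n + 1 : ℕ)))) s =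
      limitKernel a (⌈s * (n + 1 : ℕ)⌉₊ / (n + 1 : ℕ)) -
        limitKernel a ((max ⌈s * (n + 1 : ℕ)⌉₊ (M + 1) : ℕ) / (n + 1 : ℕ)) := by
    have hpos : 1 ≤ ⌈s * (n + 1 : ℕ)⌉₊ := Nat.one_le_iff_ne_zero.2
      (Nat.ceil_pos.2 (by positivity)).ne'
    induction M with
    | zero =>
      rw [Finset.sum_range_zero, zero_add, max_eq_left hpos, sub_self]
      simp [stepFunction]
    | succ M ih =>
      rw [Finset.sum_range_succ, stepFunction, Finsupp.sum_add_index' (by simp)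
        (by intros; ring), Finsupp.sum_single_index (by simp)]
      rw [stepFunction] at ih
      rw [ih]
      have hmem : s ∈ Ioc (0 : ℝ) ((((M + 1 : ℕ) : ℝ≥0) / (n + 1 : ℕ) : ℝ≥0) : ℝ) ↔
          ⌈s * (n + 1 : ℕ)⌉₊ ≤ M + 1 := by
        rw [Nat.ceil_le, NNReal.coe_div, NNReal.coe_natCast, NNReal.coe_natCast, mem_Ioc,
          le_div_iff₀ hN]
        exact and_iff_right hs
      rcases le_or_gt ⌈s * (n + 1 : ℕ)⌉₊ (M + 1) with hle | hgt
      · rw [indicator_of_mem (hmem.2 hle), max_eq_right hle,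
          max_eq_right (by omega : ⌈s * (n + 1 : ℕ)⌉₊ ≤ M + 1 + 1), Pi.one_apply]
        ring
      · rw [indicator_of_notMem (fun h => by have := hmem.1 h; omega), max_eq_left hgt.le,
          max_eq_left (by omega : M + 1 + 1 ≤ ⌈s * (n + 1 : ℕ)⌉₊)]
        ring
  exact hsum _

theorem stepFunction_approxStep_mem_Icc {a : ℝ} (ha : 0 < a) (n : ℕ) {s : ℝ} (hs : 0 < s) :
    stepFunction (approxStep a n) s ∈ Icc 0 (limitKernel a s) := by
  have hN : (0 : ℝ) < (n + 1 : ℕ) := by positivity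
  rw [stepFunction_approxStep a n hs]
  have hanti := antitoneOn_limitKernel ha
  have h1 : limitKernel a ((max ⌈s * (n + 1 : ℕ)⌉₊ ((n + 1) ^ 2 + 1) : ℕ) / (n + 1 : ℕ)) ≤
      limitKernel a (⌈s * (n + 1 : ℕ)⌉₊ / (n + 1 : ℕ)) := by
    refine hanti (mem_Ici.2 (by positivity)) (mem_Ici.2 (by positivity)) ?_
    gcongr
    exact le_max_left _ _
  have h2 : limitKernel a (⌈s * (n + 1 : ℕ)⌉₊ / (n + 1 : ℕ)) ≤ limitKernel a s := by
    refine hanti (mem_Ici.2 hs.le) (mem_Ici.2 (by positivity)) ?_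
    rw [le_div_iff₀ hN]
    exact Nat.le_ceil _
  have h3 : 0 ≤ limitKernel a ((max ⌈s * (n + 1 : ℕ)⌉₊ ((n + 1) ^ 2 + 1) : ℕ) / (n + 1 : ℕ)) :=
    limitKernel_nonneg ha (by positivity)
  constructor <;> linarith

theorem tendsto_stepFunction_approxStep {a : ℝ} (ha : 0 < a) {s : ℝ} (hs : 0 < s) :
    Tendsto (fun n => stepFunction (approxStep a n) s) atTop (𝓝 (limitKernel a s)) := by
  have hNat : Tendsto (fun n : ℕ => ((n + 1 : ℕ) : ℝ)) atTop atTop :=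
    tendsto_natCast_atTop_atTop.comp (tendsto_add_atTop_nat 1)
  have h1 : Tendsto (fun n : ℕ => limitKernel a (⌈s * (n + 1 : ℕ)⌉₊ / (n + 1 : ℕ))) atTop
      (𝓝 (limitKernel a s)) :=
    ((continuous_limitKernel ha).tendsto s).comp
      ((tendsto_nat_ceil_mul_div_atTop hs.le).comp hNat)
  have h2 : Tendsto (fun n : ℕ => limitKernel a
      ((max ⌈s * (n + 1 : ℕ)⌉₊ ((n + 1) ^ 2 + 1) : ℕ) / (n + 1 : ℕ))) atTop (𝓝 0) := by
    refine (tendsto_limitKernel ha).comp (tendsto_atTop_mono (fun n => ?_) hNat)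
    rw [le_div_iff₀ (by positivity)]
    have : (n + 1) * (n + 1) ≤ max ⌈s * (n + 1 : ℕ)⌉₊ ((n + 1) ^ 2 + 1) :=
      le_max_of_le_right (by nlinarith)
    exact_mod_cast this
  have h := h1.sub h2
  rw [sub_zero] at h
  exact h.congr fun n => (stepFunction_approxStep a n hs).symm

theorem tendsto_phiNormSq_approxStep {H a : ℝ} (hH : 1 / 2 < H) (ha : 0 < a)
    (hint : Integrable (fun z : ℝ × ℝ => limitKernel a z.1 * limitKernel a z.2 *
      fbmKernel H z.1 z.2) quadrantMeasure) :
    Tendsto (fun n => phiNormSq H fun s => limitKernel a s - stepFunction (approxStep a n) s)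
      atTop (𝓝 0) := by
  have hq : ∀ᵐ z ∂quadrantMeasure, z ∈ Ioi (0 : ℝ) ×ˢ Ioi (0 : ℝ) := by
    unfold quadrantMeasure
    rw [Measure.prod_restrict]
    exact ae_restrict_mem (measurableSet_Ioi.prod measurableSet_Ioi)
  have hm (n : ℕ) : Measurable fun s => limitKernel a s - stepFunction (approxStep a n) s :=
    (continuous_limitKernel ha).measurable.sub (measurable_stepFunction _)
  have h := tendsto_integral_of_dominated_convergence (μ := quadrantMeasure)
    (F := fun n (z : ℝ × ℝ) => (limitKernel a z.1 - stepFunction (approxStep a n) z.1) *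
      (limitKernel a z.2 - stepFunction (approxStep a n) z.2) * fbmKernel H z.1 z.2)
    (f := fun _ => 0) _
    (fun n => ((((hm n).comp measurable_fst).mul ((hm n).comp measurable_snd)).mul
      (measurable_fbmKernel H)).aestronglyMeasurable) hint
    (fun n => by
      filter_upwards [hq] with z hz
      have h1 := stepFunction_approxStep_mem_Icc ha n hz.1
      have h2 := stepFunction_approxStep_mem_Icc ha n hz.2
      have h3 := fbmKernel_nonneg hH z.1 z.2
      have h4 := limitKernel_nonneg ha (le_of_lt hz.1)
      rw [Real.norm_of_nonneg (mul_nonneg (mul_nonneg (sub_nonneg.2 h1.2) (sub_nonneg.2 h2.2)) h3)]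
      have h5 := h1.1
      have h6 := h2.1
      have h7 := sub_nonneg.2 h2.2
      gcongr <;> linarith)
    (by
      filter_upwards [hq] with z hz
      have h1 := (tendsto_stepFunction_approxStep ha hz.1).const_sub (limitKernel a z.1)
      have h2 := (tendsto_stepFunction_approxStep ha hz.2).const_sub (limitKernel a z.2)
      simpa using (h1.mul h2).mul_const (fbmKernel H z.1 z.2))
  simpa [phiNormSq] using h

section

variable {Ω : Type*} [MeasurableSpace Ω] {μ : Measure Ω} {H : ℝ} {B : ℝ≥0 → Ω → ℝ}

/-- The pathwise candidate `∫₀^∞ k(u) B_u du` for `∫₀^∞ h dB`, obtained from it by integrating by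
parts (`h' = -k`). -/
def pathwiseIntegral (a : ℝ) (B : ℝ≥0 → Ω → ℝ) (ω : Ω) : ℝ :=
  ∫ u in Ioi (0 : ℝ), limitDensity a u * B u.toNNReal ω

theorem integrableOn_limitDensity_mul_one_add_rpow {a : ℝ} (ha : 0 < a) (hH : 1 / 2 < H)
    (hH1 : H < 1) : IntegrableOn
      (fun u => limitDensity a u * (1 + (u.toNNReal : ℝ) ^ (2 * H))) (Ioi 0) := by
  refine integrableOn_limitDensity_mul ha (C := 2) (r := 2 * H) ?_ (by linarith) fun s hs => ?_
  · have : 0 ≤ 2 * H := by linarith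
    fun_prop (disch := assumption)
  · have h1 := Real.one_le_rpow hs (by linarith : 0 ≤ 2 * H)
    rw [Real.coe_toNNReal s (by linarith), abs_of_nonneg (by positivity)]
    linarith

namespace IsFractionalBrownianMotion

theorem ae_exists_modulus (hB : IsFractionalBrownianMotion H μ B) (hH : 1 / 2 < H) (hH1 : H < 1) :
    ∃ θ γ : ℝ, 0 ≤ θ ∧ θ < γ ∧ γ < 1 ∧
      ∀ᵐ ω ∂μ, ∃ C, 0 ≤ C ∧ HasPolynomialModulus θ γ C fun t => B t.toNNReal ω :=
  -- Both exponents lie in `(1 / 4, H - 1 / 4)`, which is nonempty exactly because `H > 1 / 2`.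
  ⟨1 / 4 + (H - 1 / 2) / 3, 1 / 4 + 2 * (H - 1 / 2) / 3, by linarith, by linarith, by linarith,
    hB.ae_exists_hasPolynomialModulus (by linarith) (by linarith) (by linarith) (by linarith)⟩

theorem ae_integrableOn_limitDensity_mul (hB : IsFractionalBrownianMotion H μ B)
    (hH : 1 / 2 < H) (hH1 : H < 1) {a : ℝ} (ha : 0 < a) :
    ∀ᵐ ω ∂μ, IntegrableOn (fun u => limitDensity a u * B u.toNNReal ω) (Ioi 0) := by
  obtain ⟨θ, γ, hθ0, hθγ, hγ1, hmod⟩ := hB.ae_exists_modulus hH hH1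
  filter_upwards [hmod, hB.continuous_paths, hB.eval_zero (by linarith)] with ω ⟨C, hC, h⟩ hc h0
  exact integrableOn_limitDensity_mul ha (hc.comp continuous_real_toNNReal) (r := θ + 1)
    (by linarith) fun s hs => h.abs_le hC hγ1.le (by simpa using h0) hs

/-- The isometry, extended to the differences of the limit kernel and a step function. -/
theorem isometry_limitKernel [SFinite μ] (hB : IsFractionalBrownianMotion H μ B)
    (hBm : Measurable (Function.uncurry B)) (hH : 1 / 2 < H) (hH1 : H < 1) {a : ℝ} (ha : 0 < a)
    (p : ℝ≥0 →₀ ℝ) :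
    Integrable (fun z : ℝ × ℝ => (limitKernel a z.1 - stepFunction p z.1) *
      (limitKernel a z.2 - stepFunction p z.2) * fbmKernel H z.1 z.2) quadrantMeasure ∧
    MemLp (fun ω => stepIntegral B p ω - pathwiseIntegral a B ω) 2 μ ∧
    ∫ ω, (stepIntegral B p ω - pathwiseIntegral a B ω) ^ 2 ∂μ =
      phiNormSq H fun s => limitKernel a s - stepFunction p s := by
  have hw := measurable_jumpWeight ha p
  have hwτ := (integrable_and_integral_jumpWeight_mul p
    (integrableOn_limitDensity_mul_one_add_rpow ha hH hH1)).1
  have h1 := integrable_and_phiNormSq_mixture hH hw measurable_real_toNNReal hwτ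
    (f := fun s => limitKernel a s - stepFunction p s)
    fun s hs => limitKernel_sub_stepFunction_eq ha p hs
  have h2 := memLp_and_integral_sq_mixture hH hB hBm hw measurable_real_toNNReal hwτ
  have hae : (fun ω => ∫ u, jumpWeight a p u * B u.toNNReal ω ∂(jumpMeasure p)) =ᵐ[μ]
      fun ω => pathwiseIntegral a B ω - stepIntegral B p ω := by
    filter_upwards [hB.ae_integrableOn_limitDensity_mul hH hH1 ha, hB.eval_zero (by linarith)]
      with ω hω h0
    rw [(integrable_and_integral_jumpWeight_mul p hω).2, pathwiseIntegral, stepIntegral]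
    simp only [Real.toNNReal_coe, h0, sub_zero]
  refine ⟨h1.1, ?_, ?_⟩
  · have := (h2.1.ae_eq hae).neg
    refine this.ae_eq (Eventually.of_forall fun ω => ?_)
    simp
  · rw [h1.2, ← h2.2]
    refine integral_congr_ae ?_
    filter_upwards [hae] with ω hω
    rw [hω]
    ring

theorem tendsto_eLpNorm_stepIntegral [SFinite μ] (hB : IsFractionalBrownianMotion H μ B)
    (hBm : Measurable (Function.uncurry B)) (hH : 1 / 2 < H) (hH1 : H < 1) {a : ℝ} (ha : 0 < a)
    {p : ℕ → ℝ≥0 →₀ ℝ}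
    (hp : Tendsto (fun n => phiNormSq H fun s => limitKernel a s - stepFunction (p n) s)
      atTop (𝓝 0)) :
    Tendsto (fun n => eLpNorm (fun ω => stepIntegral B (p n) ω - pathwiseIntegral a B ω) 2 μ)
      atTop (𝓝 0) := by
  have h1 (n : ℕ) : eLpNorm (fun ω => stepIntegral B (p n) ω - pathwiseIntegral a B ω) 2 μ =
      ENNReal.ofReal (√(phiNormSq H fun s => limitKernel a s - stepFunction (p n) s)) := by
    obtain ⟨-, h2, h3⟩ := hB.isometry_limitKernel hBm hH hH1 ha (p n)
    rw [h2.eLpNorm_eq_integral_rpow_norm (by norm_num) (by norm_num), ← h3, Real.sqrt_eq_rpow]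
    simp
  simp_rw [h1]
  have h2 := ((ENNReal.continuous_ofReal.comp Real.continuous_sqrt).tendsto 0).comp hp
  simpa only [Function.comp_def, Real.sqrt_zero, ENNReal.ofReal_zero] using h2

theorem isFbmIntegral_pathwiseIntegral [SFinite μ] (hB : IsFractionalBrownianMotion H μ B)
    (hBm : Measurable (Function.uncurry B)) (hH : 1 / 2 < H) (hH1 : H < 1) {a : ℝ} (ha : 0 < a) :
    IsFbmIntegral H μ B (limitKernel a) (pathwiseIntegral a B) := by
  obtain ⟨h1, h2, -⟩ := hB.isometry_limitKernel hBm hH hH1 ha 0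
  simp only [stepFunction, stepIntegral, Finsupp.sum_zero_index, sub_zero, zero_sub] at h1 h2
  have hlim := tendsto_phiNormSq_approxStep hH ha h1
  exact ⟨⟨(continuous_limitKernel ha).aestronglyMeasurable, h1⟩,
    h2.neg.ae_eq (Eventually.of_forall fun ω => by simp), approxStep a, hlim,
    hB.tendsto_eLpNorm_stepIntegral hBm hH hH1 ha hlim⟩

theorem ae_eq_pathwiseIntegral [SFinite μ] (hB : IsFractionalBrownianMotion H μ B)
    (hBm : Measurable (Function.uncurry B)) (hH : 1 / 2 < H) (hH1 : H < 1) {a : ℝ} (ha : 0 < a)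
    {I : Ω → ℝ} (hI : IsFbmIntegral H μ B (limitKernel a) I) : I =ᵐ[μ] pathwiseIntegral a B := by
  obtain ⟨-, hI2, p, hp, hpI⟩ := hI
  have hpL := hB.tendsto_eLpNorm_stepIntegral hBm hH hH1 ha hp
  have hL : MemLp (pathwiseIntegral a B) 2 μ :=
    (hB.isFbmIntegral_pathwiseIntegral hBm hH hH1 ha).2.1
  have hS (n : ℕ) : AEStronglyMeasurable (stepIntegral B (p n)) μ := by
    have := (hB.isometry_limitKernel hBm hH hH1 ha (p n)).2.1.aestronglyMeasurable.add
      hL.aestronglyMeasurable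
    exact this.congr (Eventually.of_forall fun ω => by simp)
  have hle (n : ℕ) : eLpNorm (I - pathwiseIntegral a B) 2 μ ≤
      eLpNorm (fun ω => stepIntegral B (p n) ω - pathwiseIntegral a B ω) 2 μ +
        eLpNorm (fun ω => stepIntegral B (p n) ω - I ω) 2 μ := by
    have e : I - pathwiseIntegral a B =
        (fun ω => stepIntegral B (p n) ω - pathwiseIntegral a B ω) -
          fun ω => stepIntegral B (p n) ω - I ω := by
      funext ω
      simp
    rw [e]
    exact eLpNorm_sub_le ((hS n).sub hL.aestronglyMeasurable) ((hS n).sub hI2.aestronglyMeasurable)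
      (by norm_num)
  have h0 : eLpNorm (I - pathwiseIntegral a B) 2 μ = 0 :=
    le_antisymm (by simpa using ge_of_tendsto' (hpL.add hpI) hle) zero_le
  have := (eLpNorm_eq_zero_iff (hI2.aestronglyMeasurable.sub hL.aestronglyMeasurable)
    (by norm_num)).1 h0
  filter_upwards [this] with ω hω
  simpa [sub_eq_zero] using hω

theorem congr_ae (hB : IsFractionalBrownianMotion H μ B) {B' : ℝ≥0 → Ω → ℝ}
    (h : ∀ᵐ ω ∂μ, ∀ t, B' t ω = B t ω) : IsFractionalBrownianMotion H μ B' where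
  gaussian := hB.gaussian.congr fun t => by filter_upwards [h] with ω hω using (hω t).symm
  centered t := by
    rw [← hB.centered t]
    exact integral_congr_ae (by filter_upwards [h] with ω hω using hω t)
  covariance t s := by
    rw [← hB.covariance t s]
    exact integral_congr_ae (by filter_upwards [h] with ω hω; rw [hω t, hω s])
  continuous_paths := by
    filter_upwards [h, hB.continuous_paths] with ω hω hc
    simpa only [hω] using hc

end IsFractionalBrownianMotion

theorem IsFbmIntegral.congr_ae {f : ℝ → ℝ} {I : Ω → ℝ} (hI : IsFbmIntegral H μ B f I)
    {B' : ℝ≥0 → Ω → ℝ} (h : ∀ᵐ ω ∂μ, ∀ t, B' t ω = B t ω) : IsFbmIntegral H μ B' f I := by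
  obtain ⟨h1, h2, p, hp, hpI⟩ := hI
  refine ⟨h1, h2, p, hp, hpI.congr fun n => eLpNorm_congr_ae ?_⟩
  filter_upwards [h] with ω hω
  simp only [stepIntegral, hω]

end

end

/-! ### Convergence of the diffusion -/

theorem theorem3p3 {Ω : Type*} [MeasurableSpace Ω] (μ : Measure Ω) [IsProbabilityMeasure μ]
    (H : ℝ) (hH : 1 / 2 < H) (hH_lt : H < 1) (a : ℝ) (ha : 0 < a) (ν : ℝ)
    (B : ℝ≥0 → Ω → ℝ) (hB : IsFractionalBrownianMotion H μ B)
    (X : ℝ≥0 → Ω → ℝ) (hX : IsLinearSelfAttractingDiffusion μ B a ν X) :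
    IntegrableOn (limitKernel a) (Ioi 0) ∧
    (∃ I : Ω → ℝ, IsFbmIntegral H μ B (limitKernel a) I) ∧
    ∀ I : Ω → ℝ, IsFbmIntegral H μ B (limitKernel a) I →
      ∀ᵐ ω ∂μ, Tendsto (fun t : ℝ≥0 => X t ω) atTop
        (𝓝 (I ω + ν * ∫ s in Ioi 0, limitKernel a s)) := by
  obtain ⟨B', hB'm, hB'c, hBB'⟩ :=
    exists_measurable_continuous_modification hB.gaussian.aemeasurable hB.continuous_paths
  have hB' : IsFractionalBrownianMotion H μ B' := hB.congr_ae hBB'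
  have hB'j : Measurable (Function.uncurry B') :=
    measurable_uncurry_of_continuous_of_measurable hB'c hB'm
  refine ⟨integrableOn_limitKernel ha, ⟨pathwiseIntegral a B',
    (hB'.isFbmIntegral_pathwiseIntegral hB'j hH hH_lt ha).congr_ae
      (by filter_upwards [hBB'] with ω hω t using (hω t).symm)⟩, fun I hI => ?_⟩
  have hIL := hB'.ae_eq_pathwiseIntegral hB'j hH hH_lt ha (hI.congr_ae hBB')
  obtain ⟨θ, γ, hθ0, hθγ, hγ1, hmod⟩ := hB'.ae_exists_modulus hH hH_lt
  filter_upwards [hBB', hIL, hmod, hB'.eval_zero (by linarith), hX.continuous_paths, hX.equation,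
    hB'.ae_integrableOn_limitDensity_mul hH hH_lt ha] with ω hBω hIω ⟨C, hC, hmodω⟩ h0 hXc hXeq hint
  have hlim := tendsto_of_linear_selfAttracting ha (b := fun t => B' t.toNNReal ω + ν * t)
    (x := fun t => X t.toNNReal ω)
    (((hB'c ω).comp continuous_real_toNNReal).add (continuous_const.mul continuous_id))
    (hXc.comp continuous_real_toNNReal) (by simpa using h0) (by positivity) hγ1
    (hθ0.trans hθγ.le) hθγ (hmodω.add_linear hθ0 ν) fun t ht => by
      rw [hXeq, hBω, Real.coe_toNNReal t ht]
      ring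
  have hval : ∫ s in Ioi 0, limitDensity a s * (B' s.toNNReal ω + ν * s) =
      I ω + ν * ∫ s in Ioi 0, limitKernel a s := by
    rw [hIω, pathwiseIntegral, ← integral_limitDensity_mul_id ha, ← integral_const_mul,
      ← integral_add hint ((integrableOn_limitDensity_mul_id ha).const_mul ν)]
    congr 1
    funext s
    ring
  rw [hval] at hlim
  refine (hlim.comp (NNReal.tendsto_coe_atTop.2 tendsto_id)).congr fun t => ?_
  simp
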